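/- Let $G$ be an Abelian Polish group (written additively) and let $\mu$ be a Borel probability measure on $G$. For $x\in G$ let $\mathrm{RW}(x,\mu)$ be the law on $G^{\mathbb N}$ of the random walk $S^x_n = x+X_1+\dots+X_n$, $n\ge 0$, where $X_1,X_2,\dots$ are i.i.d. with distribution $\mu$. A successful exact coupling of $\mathrm{RW}(x,\mu)$ and $\mathrm{RW}(y,\mu)$ is a triple $(S^x,S^y,T)$ on a probability space with $S^x\sim\mathrm{RW}(x,\mu)$, $S^y\sim\mathrm{RW}(y,\mu)$ and $T$ an a.s. finite random time such that $S^x_n=S^y_n$ for all $n\ge T$. Let $G_s$ be the set of all $x\in G$ such that $\mathrm{RW}(0,\mu)$ and $\mathrm{RW}(x,\mu)$ admit a successful exact coupling. Write $\mu^n$ for the $n$-fold convolution of $\mu$ with itself, $\theta_x\nu(B)=\nu(B-x)$ (so $\theta_x^{-1}\nu(B)=\nu(x+B)$), $\nu_1\wedge\nu_2$ for the largest measure smaller than both $\nu_1$ and $\nu_2$, and $\|\nu\|=\sup_B\nu(B)-\inf_B\nu(B)$ for the total variation of a finite signed measure. Then: (a) $G_s=\{x\in G:\ \exists n\ge 1,\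 \mu^n\wedge\theta_x^{-1}\mu^n\ne 0\}$. (b) For every $x\in G_s$ and every $n_0\ge 1$ with $\mu^{n_0}\wedge\theta_x^{-1}\mu^{n_0}\neq 0$ there is $C=C(\mu,x,n_0)>0$ such that, whenever $S\sim\mathrm{RW}(0,\mu)$ and $S^x\sim\mathrm{RW}(x,\mu)$ under $\mathbf P$: if $x$ has infinite order, then $\|\mathbf P(S_n\in\cdot)-\mathbf P(S^x_n\in\cdot)\|\le C/\sqrt n$ for all $n\ge 1$; and if $x$ has finite order, there is $\rho=\rho(\mu,x,n_0)\in(0,1)$ such that $\|\mathbf P(S_n\in\cdot)-\mathbf P(S^x_n\in\cdot)\|\le C\rho^n$ for all $n\ge 1$. (c) Suppose $G$ is locally compact with Haar measure $\lambda$, and call $\mu$ spread out if for some $n\ge 1$ and some Borel $f\ge 0$ that is not $\lambda$-a.e. zero one has $\mu^n\ge\int_{\cdot} f\,d\lambda$. If $G_s=G$, then $\mu$ is spread out. If $G$ is connected, the converse holds as well. (d) If $\mu$ is purely atomic and $A$ is its set of atoms, then $G_s$ is the subgroup of $G$ generated by $A-A=\{a-a':a,a'\in A\}$. (e) $G_s$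 is a Borel measurable subgroup of $G$. -/

import Mathlib

open MeasureTheory Set
open scoped ENNReal Pointwise

universe u v

noncomputable section

namespace ExactCoupling

section Basic

variable {G : Type u} [AddCommGroup G] [MeasurableSpace G]

/-- The `n`-fold convolution `μ ^ n` of a measure with itself (with `μ ^ 0 = δ_0`). -/
def convPow (μ : Measure G) : ℕ → Measure G
  | 0 => Measure.dirac 0
  | n + 1 => (convPow μ n).conv μ

/-- The shift `θ_x ν`, i.e. `(θ_x ν)(B) = ν(-x + B)`: all the mass of `ν` is translated by `x`. -/
def shift (x : G) (ν : Measure G) : Measure G :=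
  ν.map (fun y => x + y)

/-- The law `RW(x, μ)` on `G^ℕ` of the random walk `S_n = x + X_1 + ⋯ + X_n` whose steps
`X_1, X_2, …` (here indexed from `0`) are i.i.d. with distribution `μ`. -/
def rwLaw (x : G) (μ : Measure G) : Measure (ℕ → G) :=
  (Measure.infinitePi (fun _ : ℕ => μ)).map
    (fun X : ℕ → G => fun n : ℕ => x + ∑ i ∈ Finset.range n, X i)

/-- `S` is an `(x, μ)`-random walk under `P`: a process with law `RW(x, μ)`. -/
structure IsRandomWalk (x : G) (μ : Measure G) {Ω : Type v} [MeasurableSpace Ω]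
    (P : Measure Ω) (S : ℕ → Ω → G) : Prop where
  measurable : ∀ n, Measurable (S n)
  map_eq : P.map (fun ω n => S n ω) = rwLaw x μ

/-- `(S, S', T)` is an exact coupling of `RW(x, μ)` and `RW(y, μ)` under `P`; the coupling time
`T` may be infinite. -/
structure IsExactCoupling (μ : Measure G) (x y : G) {Ω : Type v} [MeasurableSpace Ω]
    (P : Measure Ω) (S S' : ℕ → Ω → G) (T : Ω → ℕ∞) : Prop where
  left : IsRandomWalk x μ P S
  right : IsRandomWalk y μ P S'
  measurable_time : Measurable T
  eq_of_time_le : ∀ ω (n : ℕ), T ω ≤ n → S n ω = S' n ω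

/-- An exact coupling is successful if its coupling time is almost surely finite. -/
structure IsSuccessfulExactCoupling (μ : Measure G) (x y : G) {Ω : Type v} [MeasurableSpace Ω]
    (P : Measure Ω) (S S' : ℕ → Ω → G) (T : Ω → ℕ∞) : Prop
    extends IsExactCoupling μ x y P S S' T where
  time_lt_top : ∀ᵐ ω ∂P, T ω < ⊤

/-- The successful exact coupling set `G_s`: those `x` for which, on some probability space,
there is a successful exact coupling of `RW(0, μ)` and `RW(x, μ)`. -/
def couplingSet (μ : Measure G) : Set G :=
  {x | ∃ (Ω : Type u) (_ : MeasurableSpace Ω) (P : Measure Ω) (_ : IsProbabilityMeasure P)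
      (S S' : ℕ → Ω → G) (T : Ω → ℕ∞), IsSuccessfulExactCoupling μ 0 x P S S' T}

/-- `μ` is spread out with respect to the (Haar) measure `haar`: some convolution power `μ ^ n`,
`n ≥ 1`, dominates a measure `∫_· f d(haar)` with `f ≥ 0` Borel and not a.e. zero. -/
def IsSpreadOut (haar μ : Measure G) : Prop :=
  ∃ n : ℕ, 1 ≤ n ∧ ∃ f : G → ℝ≥0∞, Measurable f ∧ ¬ (f =ᵐ[haar] 0) ∧
    haar.withDensity f ≤ convPow μ n

/-- The set of atoms (points of positive mass) of `μ`. -/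
def atoms (μ : Measure G) : Set G := {a | μ {a} ≠ 0}

/-- `μ` is purely atomic: it is carried by its set of atoms. -/
def IsPurelyAtomic (μ : Measure G) : Prop := μ (atoms μ)ᶜ = 0

end Basic

/-- The total variation `sup_B ν(B) - inf_B ν(B)` of a finite signed measure, with `B` ranging
over the measurable sets. -/
def tvNorm {E : Type u} [MeasurableSpace E] (ν : SignedMeasure E) : ℝ :=
  (⨆ B : {B : Set E // MeasurableSet B}, ν B.1) - ⨅ B : {B : Set E // MeasurableSet B}, ν B.1

/-- The total variation distance `‖P(Y ∈ ·) - P(Z ∈ ·)‖` of the laws of `Y` and `Z`. -/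
def tvDist {Ω : Type v} [MeasurableSpace Ω] (P : Measure Ω) [IsFiniteMeasure P]
    {E : Type u} [MeasurableSpace E] (Y Z : Ω → E) : ℝ :=
  tvNorm ((P.map Y).toSignedMeasure - (P.map Z).toSignedMeasure)

end ExactCoupling

end

/-! Everything passes through `Merges μ x`: with `T` the transition operator of `μ`, the functions
`T^n (f - f(· + x))` tend to zero uniformly over all `f` bounded by one.

Overlap gives merging, with rates. If `m = ν ⊓ shift (-x) ν` is nonzero for `ν = μ^n₀`, then `m` and
`shift x m` both lie below `ν`, so `ν` equals their average plus a remainder `r`. On operators this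
reads `T_ν = T_m A + T_r`, where `A` averages a function with its translate by `x`
(`exists_decomposition`). All these operators commute with translations, so `k` steps applied to `f
- f(· + x)` give a binomial mixture of the functions `A^i (f - f(· + x))`. For these, differences of
adjacent binomial coefficients give decay of order `1 / √i`, and a contraction over one period gives
geometric decay when `x` has finite order. Mixing over `i` keeps the type of rate
(`abs_transOp_iterate_avg_diff_le`). Conversely, merging laws cannot stay mutually singular.

Merging gives a coupling. By the Markov property merging extends from one-time laws to laws of whole
tails. At each time `n` the common part of the tail laws still uncoupled is coupled; the leftover
mass vanishes (`exists_eventual_coupling`). Conversely, if the laws were singular at every positive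
time, the walks would almost surely never meet.

Since `Merges` is stable under sums and negation, the coupling set is a subgroup. The remaining
claims follow from the overlap criterion: Fubini and continuity of translation for spread out
measures, cosets of a countable subgroup for atomic ones, and measurability of singularity for
kernels. -/

namespace ExactCoupling

/-! ### Transition operators and their commutation with translations -/

section Operators

variable {G : Type*} [AddCommGroup G] [MeasurableSpace G]

/-- `f` is measurable and bounded by `K` in absolute value. -/
structure BoundedMeasurable (f : G → ℝ) (K : ℝ) : Prop where
  measurable : Measurable f
  bound : ∀ y, |f y| ≤ K

/-- The transition operator `f ↦ (y ↦ ∫ f (y + z) dν(z))` of a measure `ν`. -/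
noncomputable def transOp (ν : Measure G) (f : G → ℝ) : G → ℝ := fun y => ∫ z, f (y + z) ∂ν

/-- Average of a function and its translate by `x`. -/
noncomputable def avg (x : G) (f : G → ℝ) : G → ℝ := fun y => (f y + f (y + x)) / 2

/-- Difference of a function and its translate by `x`. -/
def diff (x : G) (f : G → ℝ) : G → ℝ := fun y => f y - f (y + x)

lemma BoundedMeasurable.nonneg {f : G → ℝ} {K : ℝ} (hf : BoundedMeasurable f K) : 0 ≤ K :=
  (abs_nonneg _).trans (hf.bound 0)

variable [MeasurableAdd₂ G]

lemma BoundedMeasurable.translate {f : G → ℝ} {K : ℝ} (hf : BoundedMeasurable f K) (x : G) :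
    BoundedMeasurable (fun y => f (y + x)) K :=
  ⟨hf.measurable.comp (measurable_id.add_const x), fun _ => hf.bound _⟩

lemma BoundedMeasurable.avg {f : G → ℝ} {K : ℝ} (hf : BoundedMeasurable f K) (x : G) :
    BoundedMeasurable (avg x f) K := by
  refine ⟨(hf.measurable.add (hf.translate x).measurable).div_const 2, fun y => ?_⟩
  have h1 := abs_le.1 (hf.bound y)
  have h2 := abs_le.1 (hf.bound (y + x))
  simp only [ExactCoupling.avg]
  rw [abs_le]
  constructor <;> linarith

lemma BoundedMeasurable.diff {f : G → ℝ} {K : ℝ} (hf : BoundedMeasurable f K) (x : G) :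
    BoundedMeasurable (diff x f) (2 * K) := by
  refine ⟨hf.measurable.sub (hf.translate x).measurable, fun y => ?_⟩
  have h1 := abs_le.1 (hf.bound y)
  have h2 := abs_le.1 (hf.bound (y + x))
  simp only [ExactCoupling.diff]
  rw [abs_le]
  constructor <;> linarith

lemma BoundedMeasurable.avg_iterate {f : G → ℝ} {K : ℝ} (hf : BoundedMeasurable f K) (x : G)
    (i : ℕ) : BoundedMeasurable ((ExactCoupling.avg x)^[i] f) K := by
  induction i with
  | zero => exact hf
  | succ i ih => rw [Function.iterate_succ_apply']; exact ih.avg x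

lemma BoundedMeasurable.integrable {f : G → ℝ} {K : ℝ} (hf : BoundedMeasurable f K)
    (ν : Measure G) [IsFiniteMeasure ν] (y : G) : Integrable (fun z => f (y + z)) ν :=
  Integrable.of_bound (hf.measurable.comp (measurable_id.const_add y)).aestronglyMeasurable K
    (.of_forall fun _ => hf.bound _)

lemma BoundedMeasurable.transOp {f : G → ℝ} {K : ℝ} (hf : BoundedMeasurable f K)
    (ν : Measure G) [IsFiniteMeasure ν] :
    BoundedMeasurable (transOp ν f) (ν.real univ * K) := by
  constructor
  · have : StronglyMeasurable (Function.uncurry fun y z : G => f (y + z)) :=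
      (hf.measurable.comp measurable_add).stronglyMeasurable
    exact (this.integral_prod_right (ν := ν)).measurable
  · intro y
    have := norm_integral_le_of_norm_le_const (μ := ν) (f := fun z => f (y + z)) (C := K)
      (.of_forall fun _ => hf.bound _)
    rwa [mul_comm]

lemma BoundedMeasurable.transOp_prob {f : G → ℝ} {K : ℝ} (hf : BoundedMeasurable f K)
    (ν : Measure G) [IsProbabilityMeasure ν] : BoundedMeasurable (ExactCoupling.transOp ν f) K := by
  simpa using hf.transOp ν

lemma BoundedMeasurable.transOp_iterate {f : G → ℝ} {K : ℝ} (hf : BoundedMeasurable f K)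
    (ν : Measure G) [IsProbabilityMeasure ν] (n : ℕ) :
    BoundedMeasurable ((ExactCoupling.transOp ν)^[n] f) K := by
  induction n with
  | zero => exact hf
  | succ n ih => rw [Function.iterate_succ_apply']; exact ih.transOp_prob ν

lemma transOp_add (ν : Measure G) [IsFiniteMeasure ν] {f g : G → ℝ} {K L : ℝ}
    (hf : BoundedMeasurable f K) (hg : BoundedMeasurable g L) :
    transOp ν (f + g) = transOp ν f + transOp ν g := by
  funext y
  exact integral_add (hf.integrable ν y) (hg.integrable ν y)

lemma transOp_iterate_add (ν : Measure G) [IsProbabilityMeasure ν] {f g : G → ℝ} {K L : ℝ}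
    (hf : BoundedMeasurable f K) (hg : BoundedMeasurable g L) (n : ℕ) :
    (transOp ν)^[n] (f + g) = (transOp ν)^[n] f + (transOp ν)^[n] g := by
  induction n with
  | zero => rfl
  | succ n ih =>
    simp only [Function.iterate_succ_apply', ih]
    exact transOp_add ν (hf.transOp_iterate ν n) (hg.transOp_iterate ν n)

lemma transOp_avg (ν : Measure G) [IsFiniteMeasure ν] {f : G → ℝ} {K : ℝ}
    (hf : BoundedMeasurable f K) (x : G) : transOp ν (avg x f) = avg x (transOp ν f) := by
  funext y
  simp only [transOp, avg]
  rw [integral_div, integral_add (hf.integrable ν y) ((hf.translate x).integrable ν y)]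
  simp only [add_right_comm]

lemma transOp_diff (ν : Measure G) [IsFiniteMeasure ν] {f : G → ℝ} {K : ℝ}
    (hf : BoundedMeasurable f K) (x : G) : transOp ν (diff x f) = diff x (transOp ν f) := by
  funext y
  simp only [transOp, diff]
  rw [integral_sub (hf.integrable ν y) ((hf.translate x).integrable ν y)]
  simp only [add_right_comm]

lemma transOp_iterate_diff (ν : Measure G) [IsProbabilityMeasure ν] {f : G → ℝ} {K : ℝ}
    (hf : BoundedMeasurable f K) (x : G) (n : ℕ) :
    (transOp ν)^[n] (diff x f) = diff x ((transOp ν)^[n] f) := by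
  induction n with
  | zero => rfl
  | succ n ih =>
    rw [Function.iterate_succ_apply', ih, transOp_diff ν (hf.transOp_iterate ν n),
      Function.iterate_succ_apply']

lemma transOp_avg_iterate_diff (ν : Measure G) [IsFiniteMeasure ν] {f : G → ℝ} {K : ℝ}
    (hf : BoundedMeasurable f K) (x : G) (i : ℕ) :
    transOp ν ((avg x)^[i] (diff x f)) = (avg x)^[i] (diff x (transOp ν f)) := by
  induction i with
  | zero => exact transOp_diff ν hf x
  | succ i ih =>
    rw [Function.iterate_succ_apply', transOp_avg ν ((hf.diff x).avg_iterate x i), ih,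
      Function.iterate_succ_apply']

instance isProbabilityMeasure_convPow (μ : Measure G) [IsProbabilityMeasure μ] (n : ℕ) :
    IsProbabilityMeasure (convPow μ n) := by
  induction n with
  | zero => rw [convPow]; infer_instance
  | succ n ih => rw [convPow]; infer_instance

instance isProbabilityMeasure_shift (x : G) (μ : Measure G) [IsProbabilityMeasure μ] :
    IsProbabilityMeasure (shift x μ) :=
  Measure.isProbabilityMeasure_map (measurable_id.const_add x).aemeasurable

instance isFiniteMeasure_shift (x : G) (μ : Measure G) [IsFiniteMeasure μ] :
    IsFiniteMeasure (shift x μ) := by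
  rw [shift]; infer_instance

lemma transOp_shift (ν : Measure G) {f : G → ℝ} (hf : Measurable f) (x y : G) :
    transOp (shift x ν) f y = transOp ν f (y + x) := by
  simp only [transOp, shift]
  have hm : Measurable fun z => f (y + z) := hf.comp (measurable_id.const_add y)
  have hx : Measurable fun z : G => x + z := measurable_id.const_add x
  rw [integral_map hx.aemeasurable hm.aestronglyMeasurable]
  simp only [add_assoc]

lemma transOp_convPow (μ : Measure G) [IsProbabilityMeasure μ] {f : G → ℝ} {K : ℝ}
    (hf : BoundedMeasurable f K) (n : ℕ) :
    transOp (convPow μ n) f = (transOp μ)^[n] f := by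
  induction n generalizing f with
  | zero =>
    funext y
    simp only [transOp, convPow, Function.iterate_zero, id]
    have hm : Measurable fun z => f (y + z) := hf.measurable.comp (measurable_id.const_add y)
    rw [integral_dirac' _ _ hm.stronglyMeasurable, add_zero]
  | succ n ih =>
    rw [Function.iterate_succ_apply, ← ih (hf.transOp_prob μ)]
    funext y
    have hm : Measurable fun p : G × G => f (y + (p.1 + p.2)) :=
      hf.measurable.comp (measurable_add.const_add y)
    have hm' : Measurable fun z => f (y + z) := hf.measurable.comp (measurable_id.const_add y)
    simp only [transOp, convPow, Measure.conv]
    rw [integral_map measurable_add.aemeasurable hm'.aestronglyMeasurable, integral_prod]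
    · simp only [add_assoc]
    · exact Integrable.of_bound hm.aestronglyMeasurable K (.of_forall fun _ => hf.bound _)

lemma transOp_convPow_iterate (μ : Measure G) [IsProbabilityMeasure μ] {f : G → ℝ} {K : ℝ}
    (hf : BoundedMeasurable f K) (n k : ℕ) :
    (transOp (convPow μ n))^[k] f = (transOp μ)^[n * k] f := by
  induction k with
  | zero => rfl
  | succ k ih =>
    rw [Function.iterate_succ_apply', ih, transOp_convPow μ (hf.transOp_iterate μ _),
      ← Function.iterate_add_apply, Nat.mul_succ, add_comm]

/-- The operators of `m` and `r` commute past `avg` and `diff` onto `f`, where they only scale the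
bound `K` by their masses. Hence no binomial expansion is needed: any `w` dominating the two-term
recursion is a bound, and the two rates come from two choices of `w`. -/
lemma abs_transOp_iterate_avg_diff_le {ν m r : Measure G} [IsProbabilityMeasure ν]
    [IsFiniteMeasure m] [IsFiniteMeasure r] {x : G}
    (hν : ∀ f K, BoundedMeasurable f K → transOp ν f = transOp m (avg x f) + transOp r f)
    (w : ℕ → ℕ → ℝ)
    (hw : ∀ i f K, BoundedMeasurable f K → ∀ y, |(avg x)^[i] (diff x f) y| ≤ K * w 0 i)
    (hrec : ∀ k i, m.real univ * w k (i + 1) + r.real univ * w k i ≤ w (k + 1) i)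
    (k i : ℕ) {f : G → ℝ} {K : ℝ} (hf : BoundedMeasurable f K) (y : G) :
    |(transOp ν)^[k] ((avg x)^[i] (diff x f)) y| ≤ K * w k i := by
  induction k generalizing i f K with
  | zero => exact hw i f K hf y
  | succ k ih =>
    have hM := hf.transOp m
    have hR := hf.transOp r
    have key : transOp ν ((avg x)^[i] (diff x f)) = (avg x)^[i + 1] (diff x (transOp m f)) +
        (avg x)^[i] (diff x (transOp r f)) := by
      rw [hν _ _ ((hf.diff x).avg_iterate x i), ← Function.iterate_succ_apply' (avg x),
        transOp_avg_iterate_diff m hf, transOp_avg_iterate_diff r hf]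
    rw [Function.iterate_succ_apply, key, transOp_iterate_add ν
      ((hM.diff x).avg_iterate x _) ((hR.diff x).avg_iterate x _)]
    calc _ ≤ (m.real univ * K) * w k (i + 1) + (r.real univ * K) * w k i :=
          (abs_add_le _ _).trans (add_le_add (ih _ hM) (ih _ hR))
      _ = K * (m.real univ * w k (i + 1) + r.real univ * w k i) := by ring
      _ ≤ _ := mul_le_mul_of_nonneg_left (hrec k i) hf.nonneg

end Operators

/-! ### Iterated averages of a difference: binomial weights -/

section Binomial

/-- This is the variance of a symmetric binomial variable, read off from the Bernstein variance
identity at `1 / 2`. -/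
lemma sum_choose_mul_sub_sq (n : ℕ) :
    ∑ i ∈ Finset.range (n + 1), (n.choose i : ℝ) * ((n : ℝ) - 2 * i) ^ 2 = (n : ℝ) * 2 ^ n := by
  have h := congrArg (Polynomial.eval (1 / 2 : ℝ)) (bernsteinPolynomial.variance ℝ n)
  simp only [Polynomial.eval_finsetSum, bernsteinPolynomial, Polynomial.eval_mul,
    Polynomial.eval_pow, Polynomial.eval_sub, nsmul_eq_mul, Polynomial.eval_natCast,
    Polynomial.eval_X, Polynomial.eval_one] at h
  have h2 : ∀ i ∈ Finset.range (n + 1), (n.choose i : ℝ) * ((n : ℝ) - 2 * i) ^ 2 =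
      4 * 2 ^ n * (((n : ℝ) * (1 / 2) - i) ^ 2 *
        (n.choose i * (1 / 2) ^ i * (1 - 1 / 2) ^ (n - i))) := by
    intro i hi
    have : i ≤ n := Nat.lt_succ_iff.1 (Finset.mem_range.1 hi)
    have h3 : (1 / 2 : ℝ) ^ i * (1 - 1 / 2) ^ (n - i) * 2 ^ n = 1 := by
      rw [show (1 - 1 / 2 : ℝ) = 1 / 2 by norm_num, ← pow_add, Nat.add_sub_cancel' this,
        ← mul_pow]
      norm_num
    linear_combination (-(n.choose i : ℝ) * ((n : ℝ) - 2 * i) ^ 2) * h3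
  rw [Finset.sum_congr rfl h2, ← Finset.mul_sum, h]
  ring

/-- Cauchy–Schwarz with weights `n.choose i` bounds the first absolute moment by the variance. -/
lemma sum_choose_mul_abs_le (n : ℕ) :
    ∑ i ∈ Finset.range (n + 1), (n.choose i : ℝ) * |(n : ℝ) - 2 * i| ≤ 2 ^ n * √n := by
  have h := Finset.sum_mul_sq_le_sq_mul_sq (Finset.range (n + 1))
    (fun i => √(n.choose i : ℝ)) (fun i => √(n.choose i : ℝ) * |(n : ℝ) - 2 * i|)
  have h1 : ∀ i : ℕ, √(n.choose i : ℝ) ^ 2 = n.choose i := fun i => Real.sq_sqrt (by positivity)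
  have h0 : ∑ i ∈ Finset.range (n + 1), (n.choose i : ℝ) = 2 ^ n := by
    exact_mod_cast Nat.sum_range_choose n
  simp only [mul_pow, h1, sq_abs, ← mul_assoc, ← sq] at h
  rw [sum_choose_mul_sub_sq, h0] at h
  refine abs_le_of_sq_le_sq' ?_ (by positivity) |>.2
  rw [mul_pow, Real.sq_sqrt (by positivity)]
  calc _ ≤ _ := h
    _ = _ := by ring

variable {G : Type*} [AddCommGroup G]

lemma avg_iterate_apply (x : G) (f : G → ℝ) (j : ℕ) (y : G) :
    (avg x)^[j] f y =
      (∑ i ∈ Finset.range (j + 1), (j.choose i : ℝ) * f (y + i • x)) / 2 ^ j := by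
  induction j generalizing y with
  | zero => simp
  | succ j ih =>
    have e : ∀ i : ℕ, y + x + i • x = y + (i + 1) • x := fun i => by rw [succ_nsmul']; abel
    rw [Function.iterate_succ_apply', avg, ih, ih, pow_succ, Finset.sum_range_succ' _ (j + 1)]
    simp only [e, Nat.choose_succ_succ, Nat.cast_add, add_mul, Finset.sum_add_distrib,
      Nat.choose_zero_right, Nat.cast_one, one_mul, zero_smul, add_zero]
    rw [Finset.sum_range_succ' (fun i => (j.choose i : ℝ) * f (y + i • x)) j,
      Finset.sum_range_succ (fun i => (j.choose (i + 1) : ℝ) * f (y + (i + 1) • x)) j]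
    simp only [Nat.choose_succ_self, Nat.cast_zero, zero_mul, Nat.choose_zero_right, Nat.cast_one,
      one_mul, zero_smul, add_zero]
    field_simp
    ring

lemma avg_iterate_diff (x : G) (f : G → ℝ) (j : ℕ) :
    (avg x)^[j] (diff x f) = diff x ((avg x)^[j] f) := by
  induction j with
  | zero => rfl
  | succ j ih =>
    rw [Function.iterate_succ_apply', ih, Function.iterate_succ_apply']
    funext y
    simp only [avg, diff]
    ring

/-- The coefficient of `f (y + i • x)` is a difference of neighbouring binomial coefficients, and
`C(j,i) - C(j,i-1) = C(j+1,i) (j+1-2i) / (j+1)`. This form exposes the first absolute moment of a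
binomial variable. -/
lemma avg_iterate_diff_apply (x : G) (f : G → ℝ) (j : ℕ) (y : G) :
    (avg x)^[j] (diff x f) y =
      (∑ i ∈ Finset.range (j + 2), ((j + 1).choose i : ℝ) * (((j + 1 : ℕ) : ℝ) - 2 * i) *
        f (y + i • x)) / ((j + 1) * 2 ^ j) := by
  have e : ∀ i : ℕ, y + x + i • x = y + (i + 1) • x := fun i => by rw [succ_nsmul']; abel
  rw [avg_iterate_diff, diff, avg_iterate_apply, avg_iterate_apply]
  simp only [e]
  set F : ℕ → ℝ := fun i => f (y + i • x)
  change (∑ i ∈ Finset.range (j + 1), (j.choose i : ℝ) * F i) / 2 ^ j -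
    (∑ i ∈ Finset.range (j + 1), (j.choose i : ℝ) * F (i + 1)) / 2 ^ j =
    (∑ i ∈ Finset.range (j + 2), ((j + 1).choose i : ℝ) * (((j + 1 : ℕ) : ℝ) - 2 * i) * F i) /
      ((j + 1) * 2 ^ j)
  have h1 : ((j : ℝ) + 1) * ∑ i ∈ Finset.range (j + 1), (j.choose i : ℝ) * F i =
      ∑ i ∈ Finset.range (j + 2), ((j + 1).choose i : ℝ) * ((j : ℝ) + 1 - i) * F i := by
    rw [Finset.sum_range_succ _ (j + 1), Finset.mul_sum]
    have : ((j + 1).choose (j + 1) : ℝ) * ((j : ℝ) + 1 - ((j + 1 : ℕ) : ℝ)) * F (j + 1) = 0 := by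
      push_cast; ring
    rw [this, add_zero]
    refine Finset.sum_congr rfl fun i hi => ?_
    have hi' : i ≤ j + 1 := (Finset.mem_range.1 hi).le
    have := Nat.choose_mul_succ_eq j i
    have : (j.choose i : ℝ) * (j + 1) = ((j + 1).choose i : ℝ) * ((j : ℝ) + 1 - i) := by
      have h := congrArg (Nat.cast (R := ℝ)) this
      push_cast [Nat.cast_sub hi'] at h
      exact h
    linear_combination F i * this
  have h2 : ((j : ℝ) + 1) * ∑ i ∈ Finset.range (j + 1), (j.choose i : ℝ) * F (i + 1) =
      ∑ i ∈ Finset.range (j + 2), ((j + 1).choose i : ℝ) * i * F i := by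
    rw [Finset.sum_range_succ' _ (j + 1), Finset.mul_sum]
    simp only [Nat.cast_zero, mul_zero, zero_mul, add_zero]
    refine Finset.sum_congr rfl fun i _ => ?_
    have h := congrArg (Nat.cast (R := ℝ)) (Nat.add_one_mul_choose_eq j i)
    push_cast at h ⊢
    linear_combination F (i + 1) * h
  have h3 : ∑ i ∈ Finset.range (j + 2), ((j + 1).choose i : ℝ) *
      (((j + 1 : ℕ) : ℝ) - 2 * i) * F i =
      ((j : ℝ) + 1) * ∑ i ∈ Finset.range (j + 1), (j.choose i : ℝ) * F i -
      ((j : ℝ) + 1) * ∑ i ∈ Finset.range (j + 1), (j.choose i : ℝ) * F (i + 1) := by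
    rw [h1, h2, ← Finset.sum_sub_distrib]
    refine Finset.sum_congr rfl fun i _ => ?_
    push_cast
    ring
  rw [h3]
  have : (j : ℝ) + 1 ≠ 0 := by positivity
  field_simp

lemma abs_avg_iterate_diff_le (x : G) {f : G → ℝ} {K : ℝ} (hf : ∀ y, |f y| ≤ K) (j : ℕ) (y : G) :
    |(avg x)^[j] (diff x f) y| ≤ K * (2 / √(j + 1)) := by
  have hK : 0 ≤ K := (abs_nonneg _).trans (hf 0)
  rw [avg_iterate_diff_apply, abs_div, abs_of_pos (by positivity : (0 : ℝ) < (j + 1) * 2 ^ j),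
    div_le_iff₀ (by positivity)]
  calc _ ≤ ∑ i ∈ Finset.range (j + 2), ((j + 1).choose i : ℝ) *
        |((j + 1 : ℕ) : ℝ) - 2 * i| * K := by
        refine (Finset.abs_sum_le_sum_abs _ _).trans (Finset.sum_le_sum fun i _ => ?_)
        rw [abs_mul, abs_mul, Nat.abs_cast]
        exact mul_le_mul_of_nonneg_left (hf _) (by positivity)
    _ ≤ (2 ^ (j + 1) * √((j + 1 : ℕ) : ℝ)) * K := by
        rw [← Finset.sum_mul]
        exact mul_le_mul_of_nonneg_right (sum_choose_mul_abs_le (j + 1)) hK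
    _ = _ := by
        have h : √((j : ℝ) + 1) * √((j : ℝ) + 1) = j + 1 := Real.mul_self_sqrt (by positivity)
        have h0 : √((j : ℝ) + 1) ≠ 0 := by positivity
        push_cast
        field_simp
        linear_combination (2 ^ (j + 1) * K : ℝ) * h

/-- Differences along a full orbit of `x` telescope to zero, so one may be subtracted from the `N`
weights with `i < N`. They stay nonnegative and the total drops from `2^N` to `2^N - N`. -/
lemma abs_avg_addOrderOf_le {x : G} {f : G → ℝ} {L : ℝ}
    (hf : ∀ y, |diff x f y| ≤ L) (y : G) :
    |(avg x)^[addOrderOf x] (diff x f) y| ≤ (1 - addOrderOf x / 2 ^ addOrderOf x) * L := by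
  set N := addOrderOf x
  have htel : ∑ i ∈ Finset.range N, diff x f (y + i • x) = 0 := by
    have : ∀ i ∈ Finset.range N, diff x f (y + i • x) =
        f (y + i • x) - f (y + (i + 1) • x) := fun i _ => by
      simp only [diff, succ_nsmul, add_assoc]
    rw [Finset.sum_congr rfl this, Finset.sum_range_sub' (fun i => f (y + i • x))]
    simp [N, addOrderOf_nsmul_eq_zero]
  have hc : ∑ i ∈ Finset.range N, (N.choose i : ℝ) = 2 ^ N - 1 := by
    have := Nat.sum_range_choose N
    rw [Finset.sum_range_succ, Nat.choose_self] at this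
    rw [eq_sub_iff_add_eq]
    exact_mod_cast this
  have key : ∑ i ∈ Finset.range (N + 1), (N.choose i : ℝ) * diff x f (y + i • x) =
      ∑ i ∈ Finset.range N, ((N.choose i : ℝ) - 1) * diff x f (y + i • x) +
        diff x f (y + N • x) := by
    simp only [Finset.sum_range_succ, sub_mul, one_mul, Finset.sum_sub_distrib, htel,
      Nat.choose_self, Nat.cast_one, sub_zero]
  rw [avg_iterate_apply, key, abs_div, abs_of_pos (by positivity : (0 : ℝ) < 2 ^ N),
    div_le_iff₀ (by positivity)]
  calc _ ≤ ∑ i ∈ Finset.range N, ((N.choose i : ℝ) - 1) * L + L := by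
        refine (abs_add_le _ _).trans (add_le_add ?_ (hf _))
        refine (Finset.abs_sum_le_sum_abs _ _).trans (Finset.sum_le_sum fun i hi => ?_)
        have : (1 : ℝ) ≤ N.choose i := by
          exact_mod_cast Nat.choose_pos (Finset.mem_range.1 hi).le
        rw [abs_mul, abs_of_nonneg (sub_nonneg.2 this)]
        exact mul_le_mul_of_nonneg_left (hf _) (sub_nonneg.2 this)
    _ = _ := by
        rw [← Finset.sum_mul, Finset.sum_sub_distrib, hc]
        simp only [Finset.sum_const, Finset.card_range, nsmul_eq_mul, mul_one]
        field_simp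
        ring

lemma exists_pow_div_le {ρ₀ : ℝ} (h0 : 0 ≤ ρ₀) (h1 : ρ₀ < 1) {N : ℕ} (hN : 0 < N) :
    ∃ C ρ : ℝ, 0 < C ∧ 0 < ρ ∧ ρ < 1 ∧ ∀ n : ℕ, ρ₀ ^ (n / N) ≤ C * ρ ^ n := by
  -- The base must be strictly positive for real powers, while `ρ₀` may vanish.
  set ρ₁ := max ρ₀ (1 / 2)
  have hp : 0 < ρ₁ := lt_max_of_lt_right (by norm_num)
  have hl : ρ₁ < 1 := max_lt h1 (by norm_num)
  have hN' : (0 : ℝ) < N := by exact_mod_cast hN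
  refine ⟨ρ₁⁻¹, ρ₁ ^ (1 / N : ℝ), inv_pos.2 hp, Real.rpow_pos_of_pos hp _,
    Real.rpow_lt_one hp.le hl (by positivity), fun n => ?_⟩
  calc ρ₀ ^ (n / N) ≤ ρ₁ ^ (n / N) := pow_le_pow_left₀ h0 (le_max_left _ _) _
    _ = ρ₁ ^ ((n / N : ℕ) : ℝ) := (Real.rpow_natCast _ _).symm
    _ ≤ ρ₁ ^ ((n : ℝ) / N - 1) := by
        refine Real.rpow_le_rpow_of_exponent_ge hp hl.le ?_
        rw [sub_le_iff_le_add, div_le_iff₀ hN']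
        have : n ≤ (n / N + 1) * N := by
          have := Nat.div_add_mod n N
          have := Nat.mod_lt n hN
          nlinarith
        exact_mod_cast this
    _ = _ := by
        rw [Real.rpow_sub hp, Real.rpow_one, ← Real.rpow_natCast, ← Real.rpow_mul hp.le,
          div_eq_inv_mul]
        congr 2
        ring

lemma exists_abs_avg_iterate_diff_le_pow {x : G} (hx : IsOfFinAddOrder x) :
    ∃ C ρ : ℝ, 0 < C ∧ 0 < ρ ∧ ρ < 1 ∧ ∀ (f : G → ℝ) (K : ℝ), (∀ y, |f y| ≤ K) →
      ∀ (j : ℕ) (y : G), |(avg x)^[j] (diff x f) y| ≤ K * (C * ρ ^ j) := by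
  have hN : 0 < addOrderOf x := hx.addOrderOf_pos
  set N := addOrderOf x with hNdef
  have hlt : (N : ℝ) < 2 ^ N := by exact_mod_cast Nat.lt_two_pow_self
  have hpos : (0 : ℝ) < N / 2 ^ N := by positivity
  have hle : (N : ℝ) / 2 ^ N < 1 := (div_lt_one (by positivity)).2 hlt
  obtain ⟨C, ρ, hC, hρ, hρ1, h⟩ := exists_pow_div_le (sub_nonneg.2 hle.le)
    (by linarith : 1 - (N : ℝ) / 2 ^ N < 1) hN
  refine ⟨2 * C, ρ, by positivity, hρ, hρ1, fun f K hf j y => ?_⟩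
  have hK : 0 ≤ K := (abs_nonneg _).trans (hf 0)
  have hbase : ∀ (r : ℕ) (y : G), |(avg x)^[r] (diff x f) y| ≤ 2 * K := by
    intro r
    induction r with
    | zero =>
      intro y
      have h1 := abs_le.1 (hf y)
      have h2 := abs_le.1 (hf (y + x))
      simp only [Function.iterate_zero, id, diff]
      rw [abs_le]
      constructor <;> linarith
    | succ r ih =>
      intro y
      have h1 := abs_le.1 (ih y)
      have h2 := abs_le.1 (ih (y + x))
      rw [Function.iterate_succ_apply', avg, abs_le]
      constructor <;> linarith
  have hstep : ∀ (q r : ℕ) (y : G),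
      |(avg x)^[N * q + r] (diff x f) y| ≤ (1 - (N : ℝ) / 2 ^ N) ^ q * (2 * K) := by
    intro q r
    induction q with
    | zero => simpa using hbase r
    | succ q ih =>
      intro y
      rw [show N * (q + 1) + r = N + (N * q + r) by ring, Function.iterate_add_apply,
        avg_iterate_diff x f (N * q + r), pow_succ', mul_assoc]
      refine abs_avg_addOrderOf_le (fun y => ?_) y
      rw [← avg_iterate_diff]
      exact ih y
  have := hstep (j / N) (j % N) y
  rw [Nat.div_add_mod] at this
  calc _ ≤ _ := this
    _ ≤ (C * ρ ^ j) * (2 * K) := mul_le_mul_of_nonneg_right (h j) (by positivity)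
    _ = _ := by ring

end Binomial

/-! ### Convergence rates and merging -/

section Rates

/-- The integral `u k i` is the mean of `1 / (i + Y + 1)` for `Y` binomial with parameters `k` and
`c`. It solves the recursion exactly, and concavity of the square root turns this into the required
inequality for `w = 2 √u`. -/
lemma exists_sqrt_recursion {c : ℝ} (hc : 0 < c) (hc1 : c ≤ 1) :
    ∃ w : ℕ → ℕ → ℝ, (∀ i, w 0 i = 2 / √(i + 1)) ∧
      (∀ k i, c * w k (i + 1) + (1 - c) * w k i ≤ w (k + 1) i) ∧
      ∀ k : ℕ, w k 0 ≤ 2 / √(c * (k + 1)) := by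
  set u : ℕ → ℕ → ℝ := fun k i => ∫ s in (0 : ℝ)..1, s ^ i * (1 - c + c * s) ^ k with hu
  have hint : ∀ k i : ℕ, IntervalIntegrable (fun s : ℝ => s ^ i * (1 - c + c * s) ^ k)
      volume 0 1 := fun k i => Continuous.intervalIntegrable (by fun_prop) _ _
  have hnn : ∀ k i, 0 ≤ u k i := fun k i =>
    intervalIntegral.integral_nonneg zero_le_one fun s hs => by
      have : 0 ≤ 1 - c + c * s := by nlinarith [hs.1]
      have := hs.1
      positivity
  have hrec : ∀ k i, c * u k (i + 1) + (1 - c) * u k i = u (k + 1) i := by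
    intro k i
    simp only [hu]
    rw [← intervalIntegral.integral_const_mul, ← intervalIntegral.integral_const_mul,
      ← intervalIntegral.integral_add ((hint k (i + 1)).const_mul c)
        ((hint k i).const_mul (1 - c))]
    congr 1
    funext s
    ring
  refine ⟨fun k i => 2 * √(u k i), fun i => ?_, fun k i => ?_, fun k => ?_⟩
  · simp [hu, integral_pow, div_eq_mul_inv]
  · dsimp only
    rw [← hrec]
    set a := u k (i + 1)
    set b := u k i
    have ha := Real.sq_sqrt (hnn k (i + 1))
    have hb := Real.sq_sqrt (hnn k i)
    have : c * √a + (1 - c) * √b ≤ √(c * a + (1 - c) * b) := by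
      refine Real.le_sqrt_of_sq_le ?_
      have h : 0 ≤ c * (1 - c) * (√a - √b) ^ 2 :=
        mul_nonneg (mul_nonneg hc.le (sub_nonneg.2 hc1)) (sq_nonneg _)
      change √a ^ 2 = a at ha
      change √b ^ 2 = b at hb
      nlinarith
    linarith
  · have h : u k 0 ≤ 1 / (c * (k + 1)) := by
      have e : u k 0 = c⁻¹ * ((1 - (1 - c) ^ (k + 1)) / (k + 1)) := by
        simp only [hu, pow_zero, one_mul]
        rw [intervalIntegral.integral_comp_add_mul (fun t : ℝ => t ^ k) hc.ne', integral_pow]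
        simp
      have h0 : 0 ≤ (1 - c) ^ (k + 1) := pow_nonneg (sub_nonneg.2 hc1) _
      rw [e, one_div, mul_inv, div_eq_mul_inv]
      refine mul_le_mul_of_nonneg_left ?_ (inv_nonneg.2 hc.le)
      exact mul_le_of_le_one_left (by positivity) (by linarith)
    calc 2 * √(u k 0) ≤ 2 * √(1 / (c * (k + 1))) := by gcongr
      _ = _ := by rw [Real.sqrt_div zero_le_one, Real.sqrt_one, mul_one_div]

variable {G : Type*} [AddCommGroup G] [MeasurableSpace G]

@[simp]
lemma shift_zero (ν : Measure G) : shift 0 ν = ν := by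
  simp [shift]

variable [MeasurableAdd₂ G]

lemma shift_shift (x y : G) (ν : Measure G) : shift x (shift y ν) = shift (x + y) ν := by
  rw [shift, shift, shift, Measure.map_map (measurable_const_add x) (measurable_const_add y)]
  simp only [Function.comp_def, add_assoc]

lemma shift_mono (x : G) {ν₁ ν₂ : Measure G} (h : ν₁ ≤ ν₂) : shift x ν₁ ≤ shift x ν₂ :=
  Measure.map_mono h (measurable_const_add x)

lemma exists_decomposition {ν : Measure G} [IsProbabilityMeasure ν] {x : G}
    (h : ν ⊓ shift (-x) ν ≠ 0) :
    ∃ m r : Measure G, IsFiniteMeasure m ∧ IsFiniteMeasure r ∧ 0 < m.real univ ∧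
      m.real univ ≤ 1 ∧ r.real univ = 1 - m.real univ ∧
      ∀ f K, BoundedMeasurable f K → transOp ν f = transOp m (avg x f) + transOp r f := by
  set m := ν ⊓ shift (-x) ν
  have hm1 : m ≤ ν := inf_le_left
  -- Translating `m ≤ shift (-x) ν` by `x` shows that `ν` also dominates the translate of `m`.
  have hm2 : shift x m ≤ ν := by
    simpa [shift_shift] using shift_mono x (inf_le_right : m ≤ shift (-x) ν)
  have : IsFiniteMeasure m := isFiniteMeasure_of_le ν hm1
  set p : Measure G := (2⁻¹ : NNReal) • m + (2⁻¹ : NNReal) • shift x m with hp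
  have hpν : p ≤ ν := by
    have e : ν = (2⁻¹ : NNReal) • ν + (2⁻¹ : NNReal) • ν := by
      rw [← add_smul, show (2⁻¹ : NNReal) + 2⁻¹ = 1 by rw [← two_mul]; simp, one_smul]
    rw [e]
    have hsmul : ∀ {κ : Measure G}, κ ≤ ν → (2⁻¹ : NNReal) • κ ≤ (2⁻¹ : NNReal) • ν :=
      fun hκ => Measure.le_iff'.2 fun s => by
        simp only [Measure.smul_apply, ENNReal.smul_def, smul_eq_mul]
        gcongr
    exact add_le_add (hsmul hm1) (hsmul hm2)
  have hadd : ν - p + p = ν := Measure.sub_add_cancel_of_le hpν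
  have hr : IsFiniteMeasure (ν - p) := isFiniteMeasure_of_le ν Measure.sub_le
  have hop : ∀ f K, BoundedMeasurable f K →
      transOp ν f = transOp m (avg x f) + transOp (ν - p) f := by
    intro f K hf
    funext y
    have hs := transOp_shift m hf.measurable x y
    have hs' := congrFun (transOp_avg m hf x) y
    rw [Pi.add_apply, hs', avg, ← hs]
    simp only [transOp]
    conv_lhs => rw [← hadd]
    rw [integral_add_measure (hf.integrable _ y) (hf.integrable _ y), hp,
      integral_add_measure (hf.integrable _ y) (hf.integrable _ y),
      integral_smul_nnreal_measure, integral_smul_nnreal_measure]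
    simp only [NNReal.smul_def, NNReal.coe_inv, NNReal.coe_ofNat, smul_eq_mul]
    ring
  -- The operator identity tested on the constant one gives the masses.
  have hmass : 1 = m.real univ + (ν - p).real univ := by
    have := congrFun (hop (fun _ => 1) 1 ⟨measurable_const, fun _ => by simp⟩) 0
    simpa [transOp, avg] using this
  refine ⟨m, ν - p, this, hr, ?_, ?_, by linarith, hop⟩
  · refine ENNReal.toReal_pos ?_ (measure_ne_top m univ)
    simpa [Measure.measure_univ_eq_zero] using h
  · linarith [measureReal_nonneg (μ := ν - p) (s := univ)]

variable (μ : Measure G) [IsProbabilityMeasure μ]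

lemma exists_abs_transOp_iterate_diff_le_sqrt {x : G} {n₀ : ℕ} (hn₀ : 1 ≤ n₀)
    (h : convPow μ n₀ ⊓ shift (-x) (convPow μ n₀) ≠ 0) :
    ∃ C : ℝ, 0 < C ∧ ∀ (f : G → ℝ) (K : ℝ), BoundedMeasurable f K → ∀ n : ℕ, 1 ≤ n → ∀ y,
      |(transOp μ)^[n] (diff x f) y| ≤ K * (C / √n) := by
  obtain ⟨m, r, _, _, hm, hm1, hr, hop⟩ := exists_decomposition h
  obtain ⟨w, hw0, hrec, hw⟩ := exists_sqrt_recursion hm hm1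
  have hn₀' : (0 : ℝ) < n₀ := by exact_mod_cast hn₀
  refine ⟨2 * √(n₀ / m.real univ), by positivity, fun f K hf n hn y => ?_⟩
  -- Only multiples of `n₀` see the overlap; the leftover `n % n₀` steps are absorbed into the test
  -- function.
  have hfr := hf.transOp_iterate μ (n % n₀)
  have hn' : (0 : ℝ) < n := by exact_mod_cast hn
  have key := abs_transOp_iterate_avg_diff_le hop w
    (fun i f K hf y => by rw [hw0]; exact abs_avg_iterate_diff_le x hf.bound i y)
    (by rw [hr]; exact hrec) (n / n₀) 0 hfr y
  rw [Function.iterate_zero, id, transOp_convPow_iterate μ (hfr.diff x),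
    ← transOp_iterate_diff μ hf, ← Function.iterate_add_apply, Nat.div_add_mod] at key
  refine key.trans (mul_le_mul_of_nonneg_left ((hw _).trans ?_) hf.nonneg)
  rw [div_le_div_iff₀ (by positivity) (by positivity), mul_assoc, ← Real.sqrt_mul (by positivity)]
  gcongr
  have : n ≤ n₀ * (n / n₀ + 1) := by
    have := Nat.div_add_mod n n₀
    have := Nat.mod_lt n hn₀
    nlinarith
  have : (n : ℝ) ≤ n₀ * ((n / n₀ : ℕ) + 1) := by exact_mod_cast this
  calc (n : ℝ) ≤ _ := this
    _ = _ := by field_simp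

lemma exists_abs_transOp_iterate_diff_le_pow {x : G} (hx : IsOfFinAddOrder x) {n₀ : ℕ}
    (hn₀ : 1 ≤ n₀) (h : convPow μ n₀ ⊓ shift (-x) (convPow μ n₀) ≠ 0) :
    ∃ C ρ : ℝ, 0 < C ∧ 0 < ρ ∧ ρ < 1 ∧ ∀ (f : G → ℝ) (K : ℝ), BoundedMeasurable f K → ∀ n : ℕ,
      ∀ y, |(transOp μ)^[n] (diff x f) y| ≤ K * (C * ρ ^ n) := by
  obtain ⟨m, r, _, _, hm, hm1, hr, hop⟩ := exists_decomposition h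
  obtain ⟨C, ρ, hC, hρ, hρ1, hbd⟩ := exists_abs_avg_iterate_diff_le_pow hx
  set c := m.real univ
  obtain ⟨C', ρ', hC', hρ', hρ1', hle⟩ := exists_pow_div_le
    (by nlinarith : 0 ≤ 1 - c + c * ρ) (by nlinarith : 1 - c + c * ρ < 1) hn₀
  refine ⟨C * C', ρ', by positivity, hρ', hρ1', fun f K hf n y => ?_⟩
  have hfr := hf.transOp_iterate μ (n % n₀)
  have key := abs_transOp_iterate_avg_diff_le hop
    -- This is `C` times the mean of `ρ ^ (i + Y)` with `Y` binomial, so the recursion holds with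
    -- equality.
    (fun k i => C * ρ ^ i * (1 - c + c * ρ) ^ k)
    (fun i f K hf y => by simpa using hbd f K hf.bound i y)
    (fun k i => le_of_eq (by rw [hr]; ring)) (n / n₀) 0 hfr y
  rw [Function.iterate_zero, id, transOp_convPow_iterate μ (hfr.diff x),
    ← transOp_iterate_diff μ hf, ← Function.iterate_add_apply, Nat.div_add_mod] at key
  refine key.trans (mul_le_mul_of_nonneg_left ?_ hf.nonneg)
  rw [pow_zero, mul_one, mul_assoc]
  exact mul_le_mul_of_nonneg_left (hle n) hC.le

/-- The laws of the `n`-th steps of the random walks started in `0` and `x` merge in total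
variation. -/
def Merges (x : G) : Prop :=
  ∀ ε : ℝ, 0 < ε → ∃ N : ℕ, ∀ n, N ≤ n → ∀ f : G → ℝ, BoundedMeasurable f 1 →
    ∀ y, |(transOp μ)^[n] (diff x f) y| ≤ ε

lemma merges_of_inf_ne_zero {x : G} {n₀ : ℕ} (hn₀ : 1 ≤ n₀)
    (h : convPow μ n₀ ⊓ shift (-x) (convPow μ n₀) ≠ 0) : Merges μ x := by
  obtain ⟨C, hC, hb⟩ := exists_abs_transOp_iterate_diff_le_sqrt μ hn₀ h
  intro ε hε
  obtain ⟨N, hN⟩ := exists_nat_ge ((C / ε) ^ 2)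
  refine ⟨N + 1, fun n hn f hf y => ?_⟩
  have hn1 : 1 ≤ n := by omega
  have hn' : (0 : ℝ) < n := by exact_mod_cast hn1
  refine (hb f 1 hf n hn1 y).trans ?_
  rw [one_mul, div_le_iff₀ (Real.sqrt_pos.2 hn'), mul_comm, ← div_le_iff₀ hε]
  refine Real.le_sqrt_of_sq_le (hN.trans ?_)
  exact_mod_cast (Nat.le_succ N).trans hn

lemma merges_zero : Merges μ (0 : G) := by
  intro ε hε
  refine ⟨0, fun n _ f hf y => ?_⟩
  rw [transOp_iterate_diff μ hf, diff, add_zero, sub_self, abs_zero]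
  exact hε.le

variable {μ}

lemma Merges.neg {x : G} (h : Merges μ x) : Merges μ (-x) := by
  intro ε hε
  obtain ⟨N, hN⟩ := h ε hε
  refine ⟨N, fun n hn f hf y => ?_⟩
  have := hN n hn f hf (y + -x)
  rw [transOp_iterate_diff μ hf, diff] at this ⊢
  rwa [neg_add_cancel_right, abs_sub_comm] at this

lemma Merges.add {x x' : G} (h : Merges μ x) (h' : Merges μ x') : Merges μ (x + x') := by
  intro ε hε
  obtain ⟨N, hN⟩ := h (ε / 2) (half_pos hε)
  obtain ⟨N', hN'⟩ := h' (ε / 2) (half_pos hε)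
  refine ⟨max N N', fun n hn f hf y => ?_⟩
  have h1 := hN n (le_of_max_le_left hn) f hf y
  have h2 := hN' n (le_of_max_le_right hn) f hf (y + x)
  rw [transOp_iterate_diff μ hf, diff] at h1 h2 ⊢
  rw [add_assoc] at h2
  rw [abs_le] at *
  constructor <;> linarith

end Rates

/-! ### Random walk laws and the Markov property -/

section Markov

/-- Put a value in front of a sequence. -/
def seqCons {E : Type*} (p : E × (ℕ → E)) : ℕ → E
  | 0 => p.1
  | n + 1 => p.2 n

lemma measurable_seqCons {E : Type*} [MeasurableSpace E] :
    Measurable (seqCons : E × (ℕ → E) → ℕ → E) := by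
  refine measurable_pi_iff.2 fun n => ?_
  cases n with
  | zero => exact measurable_fst
  | succ n => exact (measurable_pi_apply n).comp measurable_snd

lemma map_seqCons_infinitePi {E : Type*} [MeasurableSpace E] (μ : Measure E)
    [IsProbabilityMeasure μ] :
    (μ.prod (Measure.infinitePi fun _ : ℕ => μ)).map seqCons =
      Measure.infinitePi fun _ : ℕ => μ := by
  classical
  refine Measure.eq_infinitePi _ fun s t ht => ?_
  obtain ⟨N, hN⟩ : ∃ N, s ⊆ Finset.range (N + 1) :=
    ⟨s.sup id, fun i hi => Finset.mem_range.2 (Nat.lt_succ_of_le (Finset.le_sup (f := id) hi))⟩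
  -- Padding the cylinder with `univ` makes its index set an initial segment, on which the first
  -- coordinate splits off.
  set t' : ℕ → Set E := fun n => if n ∈ s then t n else univ with ht'
  have hmeas : ∀ n, MeasurableSet (t' n) := fun n => by
    by_cases h : n ∈ s
    · simpa [ht', h] using ht n
    · simp [ht', h]
  have hpi : (s : Set ℕ).pi t = (Finset.range (N + 1) : Set ℕ).pi t' := by
    ext X
    simp only [mem_pi, Finset.mem_coe, ht']
    refine ⟨fun h n _ => ?_, fun h n hn => ?_⟩
    · by_cases hn : n ∈ s
      · simpa [hn] using h n hn
      · simp [hn]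
    · simpa [hn] using h n (hN hn)
  have hprod : ∏ i ∈ s, μ (t i) = ∏ i ∈ Finset.range (N + 1), μ (t' i) := by
    rw [← Finset.prod_subset hN (f := fun i => μ (t' i))]
    · exact Finset.prod_congr rfl fun i hi => by simp [ht', hi]
    · intro i _ hi
      simp [ht', hi]
  have hpre : seqCons ⁻¹' (Finset.range (N + 1) : Set ℕ).pi t' =
      t' 0 ×ˢ (Finset.range N : Set ℕ).pi fun n => t' (n + 1) := by
    ext p
    simp only [mem_preimage, mem_pi, Finset.coe_range, mem_Iio, mem_prod]
    refine ⟨fun h => ⟨h 0 (Nat.succ_pos N), fun n hn => h (n + 1) (Nat.succ_lt_succ hn)⟩,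
      fun h n hn => ?_⟩
    cases n with
    | zero => exact h.1
    | succ n => exact h.2 n (Nat.lt_of_succ_lt_succ hn)
  rw [hpi, hprod, Measure.map_apply measurable_seqCons
    (MeasurableSet.pi (Finset.countable_toSet _) fun n _ => hmeas n), hpre, Measure.prod_prod,
    Measure.infinitePi_pi _ fun n _ => hmeas (n + 1), Finset.prod_range_succ', mul_comm]

lemma boundedMeasurable_indicator {E : Type*} [MeasurableSpace E] {B : Set E} (hB : MeasurableSet B) :
    BoundedMeasurable (B.indicator (1 : E → ℝ)) 1 :=
  ⟨measurable_one.indicator hB, fun y => by by_cases h : y ∈ B <;> simp [h]⟩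

variable {G : Type*} [AddCommGroup G]

/-- The path with starting point `x` and the given steps. -/
def path (x : G) (X : ℕ → G) : ℕ → G := fun n => x + ∑ i ∈ Finset.range n, X i

lemma path_seqCons (x : G) (p : G × (ℕ → G)) (n : ℕ) :
    path x (seqCons p) (n + 1) = path (x + p.1) p.2 n := by
  simp only [path, Finset.sum_range_succ', seqCons]
  abel

variable [MeasurableSpace G] [MeasurableAdd₂ G]

lemma measurable_path_uncurry : Measurable fun p : G × (ℕ → G) => path p.1 p.2 := by
  refine measurable_pi_iff.2 fun n => measurable_fst.add ?_
  exact Finset.measurable_sum _ fun i _ => (measurable_pi_apply i).comp measurable_snd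

lemma measurable_path (x : G) : Measurable (path x) :=
  measurable_path_uncurry.comp measurable_prodMk_left

lemma rwLaw_apply (μ : Measure G) (x : G) {B : Set (ℕ → G)} (hB : MeasurableSet B) :
    rwLaw x μ B = Measure.infinitePi (fun _ : ℕ => μ) (path x ⁻¹' B) :=
  Measure.map_apply (measurable_path x) hB

variable (μ : Measure G) [IsProbabilityMeasure μ]

instance isProbabilityMeasure_rwLaw (x : G) : IsProbabilityMeasure (rwLaw x μ) :=
  Measure.isProbabilityMeasure_map (measurable_path x).aemeasurable

lemma measurable_rwLaw {B : Set (ℕ → G)} (hB : MeasurableSet B) :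
    Measurable fun y : G => rwLaw y μ B := by
  simp only [rwLaw_apply μ _ hB]
  exact measurable_measure_prodMk_left (measurable_path_uncurry hB)

lemma boundedMeasurable_rwLaw {B : Set (ℕ → G)} (hB : MeasurableSet B) :
    BoundedMeasurable (fun y : G => (rwLaw y μ).real B) 1 :=
  ⟨(measurable_rwLaw μ hB).ennreal_toReal, fun y => by
    rw [abs_of_nonneg measureReal_nonneg]; exact measureReal_le_one⟩

/-- The path seen from time `n` on. -/
def tail {E : Type*} (n : ℕ) (ω : ℕ → E) : ℕ → E := fun k => ω (k + n)

lemma measurable_tail {E : Type*} [MeasurableSpace E] (n : ℕ) :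
    Measurable (tail n : (ℕ → E) → ℕ → E) :=
  measurable_pi_iff.2 fun k => measurable_pi_apply (k + n)

lemma rwLaw_real_tail_one (x : G) {B : Set (ℕ → G)} (hB : MeasurableSet B) :
    (rwLaw x μ).real (tail 1 ⁻¹' B) = transOp μ (fun y => (rwLaw y μ).real B) x := by
  have hpre : MeasurableSet (path x ⁻¹' (tail 1 ⁻¹' B)) :=
    measurable_path x (measurable_tail 1 hB)
  have h1 : rwLaw x μ (tail 1 ⁻¹' B) = ∫⁻ z, rwLaw (x + z) μ B ∂μ := by
    rw [rwLaw_apply μ x (measurable_tail 1 hB), ← map_seqCons_infinitePi,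
      Measure.map_apply measurable_seqCons hpre,
      Measure.prod_apply (measurable_seqCons hpre)]
    refine lintegral_congr fun z => ?_
    rw [rwLaw_apply μ _ hB]
    congr 1
    ext X
    simp only [mem_preimage]
    have : tail 1 (path x (seqCons (z, X))) = path (x + z) X := by
      funext n
      exact path_seqCons x (z, X) n
    rw [this]
  rw [measureReal_def, h1, transOp]
  simp only [measureReal_def]
  have hm : Measurable fun z => rwLaw (x + z) μ B :=
    (measurable_rwLaw μ hB).comp (measurable_const_add x)
  rw [integral_toReal hm.aemeasurable (.of_forall fun z => measure_lt_top _ _)]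

/-- By the Markov property a tail event has probability `T^n g`, with `g` a function bounded by one.
Hence `Merges` controls laws of entire tails, not only one-time laws. -/
lemma rwLaw_real_tail (x : G) (n : ℕ) {B : Set (ℕ → G)} (hB : MeasurableSet B) :
    (rwLaw x μ).real (tail n ⁻¹' B) = (transOp μ)^[n] (fun y => (rwLaw y μ).real B) x := by
  induction n generalizing B with
  | zero => rfl
  | succ n ih =>
    have e : (tail (n + 1) : (ℕ → G) → ℕ → G) ⁻¹' B = tail n ⁻¹' (tail 1 ⁻¹' B) := by
      ext ω
      simp only [mem_preimage]
      have : tail (n + 1) ω = tail 1 (tail n ω) := by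
        funext k
        simp only [tail]
        congr 1
        ring
      rw [this]
    rw [e, ih (measurable_tail 1 hB), Function.iterate_succ_apply]
    simp only [rwLaw_real_tail_one μ _ hB]

lemma rwLaw_real_eval (x : G) (n : ℕ) {B : Set G} (hB : MeasurableSet B) :
    (rwLaw x μ).real {ω | ω n ∈ B} = (transOp μ)^[n] (B.indicator 1) x := by
  have h0 : MeasurableSet {ω : ℕ → G | ω 0 ∈ B} := measurable_pi_apply 0 hB
  have e : {ω : ℕ → G | ω n ∈ B} = tail n ⁻¹' {ω | ω 0 ∈ B} := by
    ext ω
    simp [tail]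
  rw [e, rwLaw_real_tail μ x n h0]
  refine congrArg (fun f => (transOp μ)^[n] f x) (funext fun y => ?_)
  rw [measureReal_def, rwLaw_apply μ y h0]
  by_cases hy : y ∈ B <;> simp [preimage, path, hy]

variable {μ}

lemma IsRandomWalk.real_map {Ω : Type*} [MeasurableSpace Ω] {P : Measure Ω} {S : ℕ → Ω → G}
    {x : G} (hS : IsRandomWalk x μ P S) (n : ℕ) {B : Set G} (hB : MeasurableSet B) :
    (P.map (S n)).real B = (transOp μ)^[n] (B.indicator 1) x := by
  have hm : MeasurableSet {ω : ℕ → G | ω n ∈ B} := measurable_pi_apply n hB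
  rw [← rwLaw_real_eval μ x n hB, ← hS.map_eq, measureReal_def, measureReal_def,
    Measure.map_apply (hS.measurable n) hB,
    Measure.map_apply (measurable_pi_iff.2 hS.measurable) hm]
  rfl

lemma convPow_real (n : ℕ) {B : Set G} (hB : MeasurableSet B) (x : G) :
    (shift x (convPow μ n)).real B = (transOp μ)^[n] (B.indicator 1) x := by
  rw [← transOp_convPow μ (boundedMeasurable_indicator hB), transOp, ← integral_indicator_one hB,
    shift]
  exact integral_map (measurable_const_add x).aemeasurable
    (measurable_one.indicator hB).aestronglyMeasurable

lemma IsRandomWalk.map_eval {Ω : Type*} [MeasurableSpace Ω] {P : Measure Ω}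
    [IsProbabilityMeasure P] {S : ℕ → Ω → G} {x : G} (hS : IsRandomWalk x μ P S) (n : ℕ) :
    P.map (S n) = shift x (convPow μ n) := by
  ext B hB
  have := (hS.real_map n hB).trans (convPow_real n hB x).symm
  rwa [measureReal_eq_measureReal_iff] at this

/-- The factor two arises because the norm is supremum minus infimum. -/
lemma tvNorm_le {E : Type*} [MeasurableSpace E] {ν : SignedMeasure E} {D : ℝ}
    (h : ∀ B, MeasurableSet B → |ν B| ≤ D) : tvNorm ν ≤ 2 * D := by
  have : Nonempty {B : Set E // MeasurableSet B} := ⟨⟨∅, MeasurableSet.empty⟩⟩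
  have h1 : (⨆ B : {B : Set E // MeasurableSet B}, ν B.1) ≤ D :=
    ciSup_le fun B => (abs_le.1 (h B.1 B.2)).2
  have h2 : -D ≤ ⨅ B : {B : Set E // MeasurableSet B}, ν B.1 :=
    le_ciInf fun B => (abs_le.1 (h B.1 B.2)).1
  rw [tvNorm]
  linarith

lemma tvDist_le {G : Type u} [AddCommGroup G] [MeasurableSpace G] [MeasurableAdd₂ G]
    {μ : Measure G} [IsProbabilityMeasure μ] {Ω : Type v} [MeasurableSpace Ω] {P : Measure Ω}
    [IsProbabilityMeasure P] {S S' : ℕ → Ω → G} {x : G} (hS : IsRandomWalk 0 μ P S)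
    (hS' : IsRandomWalk x μ P S') {n : ℕ} {D : ℝ}
    (h : ∀ f, BoundedMeasurable f 1 → ∀ y, |(transOp μ)^[n] (diff x f) y| ≤ D) :
    tvDist P (S n) (S' n) ≤ 2 * D := by
  refine tvNorm_le fun B hB => ?_
  have := h _ (boundedMeasurable_indicator hB) 0
  rwa [transOp_iterate_diff μ (boundedMeasurable_indicator hB), diff, zero_add,
    ← hS.real_map n hB, ← hS'.real_map n hB, ← Measure.toSignedMeasure_apply_measurable hB,
    ← Measure.toSignedMeasure_apply_measurable hB] at this

end Markov

/-! ### Coupling two laws so that their tails eventually agree -/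

section Gluing

open ProbabilityTheory Filter Topology

variable {E F : Type*} [MeasurableSpace E] [MeasurableSpace F]

/-- The density of `m` with respect to the image is at most one and can be pulled back along `π`. -/
lemma exists_le_map_eq {R : Measure E} [IsFiniteMeasure R] {π : E → F} (hπ : Measurable π)
    {m : Measure F} (hm : m ≤ R.map π) : ∃ D ≤ R, D.map π = m := by
  have : IsFiniteMeasure m := isFiniteMeasure_of_le _ hm
  set h := m.rnDeriv (R.map π)
  have hmeas : Measurable h := Measure.measurable_rnDeriv _ _
  refine ⟨R.withDensity fun ω => h (π ω), ?_, ?_⟩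
  · have h1 : ∀ᵐ ω ∂(R), h (π ω) ≤ 1 := ae_of_ae_map hπ.aemeasurable (Measure.rnDeriv_le_one_of_le hm)
    calc _ ≤ R.withDensity 1 := withDensity_mono h1
      _ = R := withDensity_one
  · rw [← Measure.withDensity_rnDeriv_eq m (R.map π) (Measure.absolutelyContinuous_of_le hm)]
    ext B hB
    rw [Measure.map_apply hπ hB, withDensity_apply _ (hπ hB), withDensity_apply _ hB,
      setLIntegral_map hB hmeas hπ]

lemma exists_singular_residuals {R R' : Measure E} [IsFiniteMeasure R] [IsFiniteMeasure R']
    {π : E → F} (hπ : Measurable π) :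
    ∃ D D' R₁ R₁' : Measure E, R = D + R₁ ∧ R' = D' + R₁' ∧ D.map π = D'.map π ∧
      R₁.map π ⟂ₘ R₁'.map π := by
  obtain ⟨D, hD, hDm⟩ := exists_le_map_eq (R := R) hπ
    (inf_le_left : R.map π ⊓ R'.map π ≤ R.map π)
  obtain ⟨D', hD', hDm'⟩ := exists_le_map_eq (R := R') hπ
    (inf_le_right : R.map π ⊓ R'.map π ≤ R'.map π)
  have : IsFiniteMeasure D := isFiniteMeasure_of_le _ hD
  have : IsFiniteMeasure D' := isFiniteMeasure_of_le _ hD'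
  have hR : R = D + (R - D) := by rw [add_comm, Measure.sub_add_cancel_of_le hD]
  have hR' : R' = D' + (R' - D') := by rw [add_comm, Measure.sub_add_cancel_of_le hD']
  refine ⟨D, D', R - D, R' - D', hR, hR', hDm.trans hDm'.symm, ?_⟩
  rw [Measure.mutuallySingular_iff_disjoint, disjoint_iff_inf_le]
  set κ := (R - D).map π ⊓ (R' - D').map π with hκ
  set m := R.map π ⊓ R'.map π with hm
  have : IsFiniteMeasure m := isFiniteMeasure_of_le _ (inf_le_left : m ≤ R.map π)
  have h1 : m + κ ≤ R.map π := by
    conv_rhs => rw [hR, Measure.map_add _ _ hπ, hDm]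
    exact add_le_add le_rfl inf_le_left
  have h2 : m + κ ≤ R'.map π := by
    conv_rhs => rw [hR', Measure.map_add _ _ hπ, hDm']
    exact add_le_add le_rfl inf_le_right
  -- Any overlap `κ` of the residual images could be added to the infimum `m`, which is already
  -- maximal; finiteness then forces `κ = 0`.
  have h3 : m + κ ≤ m := le_inf h1 h2
  refine Measure.le_iff'.2 fun s => ?_
  have h4 := h3 s
  rw [Measure.add_apply] at h4
  have : κ s ≤ 0 := by
    have h5 : m s + κ s ≤ m s + 0 := by simpa using h4
    exact (ENNReal.add_le_add_iff_left (measure_ne_top m s)).1 h5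
  exact this

/-- Disintegrate both measures over their common image and draw the two points conditionally
independently given the value of `π`. -/
lemma exists_coupling_of_map_eq [StandardBorelSpace E] [Nonempty E] [StandardBorelSpace F]
    {P Q : Measure E} [IsFiniteMeasure P] [IsFiniteMeasure Q] {π : E → F} (hπ : Measurable π)
    (h : P.map π = Q.map π) :
    ∃ ρ : Measure (E × E), ρ.map Prod.fst = P ∧ ρ.map Prod.snd = Q ∧
      ∀ᵐ p ∂ρ, π p.1 = π p.2 := by
  have key : ∀ (R : Measure E) [IsFiniteMeasure R], ∃ κ : Kernel F E, IsMarkovKernel κ ∧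
      κ ∘ₘ R.map π = R ∧ ∀ᵐ z ∂(R.map π), ∀ᵐ ω ∂κ z, π ω = z := by
    intro R _
    have hg : Measurable fun ω => (π ω, ω) := hπ.prodMk measurable_id
    set R₂ : Measure (F × E) := R.map fun ω => (π ω, ω) with hR₂
    have hfst : R₂.fst = R.map π := by
      rw [Measure.fst, hR₂, Measure.map_map measurable_fst hg]; rfl
    have hsnd : R₂.snd = R := by
      rw [Measure.snd, hR₂, Measure.map_map measurable_snd hg]; exact Measure.map_id
    have hdis : R.map π ⊗ₘ R₂.condKernel = R₂ := by rw [← hfst]; exact R₂.disintegrate _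
    refine ⟨R₂.condKernel, inferInstance, ?_, ?_⟩
    · rw [← Measure.snd_compProd, hdis, hsnd]
    · have hms : MeasurableSet {p : F × E | π p.2 = p.1} :=
        measurableSet_eq_fun (hπ.comp measurable_snd) measurable_fst
      have : ∀ᵐ p ∂(R₂), π p.2 = p.1 := by
        rw [hR₂, ae_map_iff hg.aemeasurable hms]
        exact .of_forall fun ω => rfl
      rw [← hdis] at this
      exact Measure.ae_ae_of_ae_compProd this
  obtain ⟨κ, _, hκ, hκπ⟩ := key P
  obtain ⟨η, _, hη, hηπ⟩ := key Q
  rw [← h] at hη hηπ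
  refine ⟨(κ ×ₖ η) ∘ₘ P.map π, ?_, ?_, ?_⟩
  · rw [Measure.map_comp _ _ measurable_fst]
    rw [← Kernel.fst_eq]
    rw [Kernel.fst_prod, hκ]
  · rw [Measure.map_comp _ _ measurable_snd]
    rw [← Kernel.snd_eq]
    rw [Kernel.snd_prod, hη]
  · have hms : MeasurableSet {p : E × E | π p.1 = π p.2} :=
      measurableSet_eq_fun (hπ.comp measurable_fst) (hπ.comp measurable_snd)
    rw [Measure.ae_comp_iff hms]
    filter_upwards [hκπ, hηπ] with z h1 h2
    rw [Kernel.prod_apply]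
    have h1' := Measure.quasiMeasurePreserving_fst (μ := κ z) (ν := η z) |>.ae h1
    have h2' := Measure.quasiMeasurePreserving_snd (μ := κ z) (ν := η z) |>.ae h2
    filter_upwards [h1', h2'] with p hp hp'
    rw [hp, hp']

/-- Parts `d n` and `d' n` with equal images under `π n` are split off successively and coupled;
what remains has mutually singular images. The final coupling is the sum of the pieces, and has the
right marginals because the residual mass tends to zero. -/
lemma exists_eventual_coupling [StandardBorelSpace E] [Nonempty E] {P Q : Measure E}
    [IsFiniteMeasure P] [IsFiniteMeasure Q] {π : ℕ → E → E} (hπ : ∀ n, Measurable (π n))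
    {σ : ℕ → E → E} (hσ : ∀ n, Measurable (σ n)) (hπσ : ∀ n k, π (n + k) = σ k ∘ π n)
    (hPQ : ∀ ε : ℝ, 0 < ε → ∃ N, ∀ n, N ≤ n → ∀ B, MeasurableSet B →
      |P.real (π n ⁻¹' B) - Q.real (π n ⁻¹' B)| ≤ ε) :
    ∃ ρ : Measure (E × E), ρ.map Prod.fst = P ∧ ρ.map Prod.snd = Q ∧
      ∀ᵐ p ∂ρ, ∃ n, π n p.1 = π n p.2 := by
  have hstep : ∀ (n : ℕ) (r : {p : Measure E × Measure E // IsFiniteMeasure p.1 ∧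
      IsFiniteMeasure p.2}), ∃ r' : {p : Measure E × Measure E // IsFiniteMeasure p.1 ∧
      IsFiniteMeasure p.2}, ∃ D D' : Measure E, r.1.1 = D + r'.1.1 ∧ r.1.2 = D' + r'.1.2 ∧
      D.map (π n) = D'.map (π n) ∧ r'.1.1.map (π n) ⟂ₘ r'.1.2.map (π n) := by
    rintro n ⟨⟨R, R'⟩, hR, hR'⟩
    dsimp only at hR hR'
    obtain ⟨D, D', R₁, R₁', h1, h2, h3, h4⟩ :=
      exists_singular_residuals (R := R) (R' := R') (hπ n)
    refine ⟨⟨⟨R₁, R₁'⟩, ?_, ?_⟩, D, D', h1, h2, h3, h4⟩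
    · exact isFiniteMeasure_of_le R (h1 ▸ Measure.le_add_left le_rfl)
    · exact isFiniteMeasure_of_le R' (h2 ▸ Measure.le_add_left le_rfl)
  choose next D D' hnext using hstep
  let r : ℕ → {p : Measure E × Measure E // IsFiniteMeasure p.1 ∧ IsFiniteMeasure p.2} :=
    fun n => Nat.rec ⟨(P, Q), inferInstance, inferInstance⟩ next n
  set R : ℕ → Measure E := fun n => (r n).1.1
  set R' : ℕ → Measure E := fun n => (r n).1.2
  set d : ℕ → Measure E := fun n => D n (r n)
  set d' : ℕ → Measure E := fun n => D' n (r n)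
  have hR0 : R 0 = P := rfl
  have hR0' : R' 0 = Q := rfl
  have hRfin : ∀ n, IsFiniteMeasure (R n) := fun n => (r n).2.1
  have hRfin' : ∀ n, IsFiniteMeasure (R' n) := fun n => (r n).2.2
  have hRd : ∀ n, R n = d n + R (n + 1) := fun n => (hnext n (r n)).1
  have hRd' : ∀ n, R' n = d' n + R' (n + 1) := fun n => (hnext n (r n)).2.1
  have hdd : ∀ n, (d n).map (π n) = (d' n).map (π n) := fun n => (hnext n (r n)).2.2.1
  have hsing : ∀ n, (R (n + 1)).map (π n) ⟂ₘ (R' (n + 1)).map (π n) :=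
    fun n => (hnext n (r n)).2.2.2
  have hdfin : ∀ n, IsFiniteMeasure (d n) := fun n =>
    isFiniteMeasure_of_le (R n) (hRd n ▸ Measure.le_add_right le_rfl)
  have hdfin' : ∀ n, IsFiniteMeasure (d' n) := fun n =>
    isFiniteMeasure_of_le (R' n) (hRd' n ▸ Measure.le_add_right le_rfl)
  clear_value R R' d d'
  clear hnext
  -- Later projections factor through earlier ones, so removed parts cancel at all later times: the
  -- residuals differ there exactly as `P` and `Q` do.
  have hinv : ∀ n k B, MeasurableSet B →
      (R n).real (π (n + k) ⁻¹' B) - (R' n).real (π (n + k) ⁻¹' B) =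
        P.real (π (n + k) ⁻¹' B) - Q.real (π (n + k) ⁻¹' B) := by
    intro n
    induction n with
    | zero => intro k B _; rw [hR0, hR0']
    | succ n ih =>
      intro k B hB
      have e : n + 1 + k = n + (k + 1) := by ring
      rw [e, ← ih (k + 1) B hB, hRd n, hRd' n, measureReal_add_apply, measureReal_add_apply]
      have : (d n).real (π (n + (k + 1)) ⁻¹' B) = (d' n).real (π (n + (k + 1)) ⁻¹' B) := by
        rw [hπσ, preimage_comp, measureReal_def, measureReal_def,
          ← Measure.map_apply (hπ n) (hσ _ hB), ← Measure.map_apply (hπ n) (hσ _ hB), hdd]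
      linarith
  have hmass : ∀ ε : ℝ, 0 < ε → ∃ N, ∀ n, N ≤ n →
      (R (n + 1)).real univ ≤ ε ∧ (R' (n + 1)).real univ ≤ ε := by
    intro ε hε
    obtain ⟨N, hN⟩ := hPQ ε hε
    refine ⟨N, fun n hn => ?_⟩
    -- On the separating set only one residual survives, so its whole mass is a difference of `P`
    -- and `Q`.
    obtain ⟨B, hB, hB1, hB2⟩ := hsing n
    rw [Measure.map_apply (hπ n) hB] at hB1
    rw [Measure.map_apply (hπ n) hB.compl] at hB2
    have hsub : ∀ {C}, MeasurableSet C →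
        (R (n + 1)).real (π n ⁻¹' C) - (R' (n + 1)).real (π n ⁻¹' C) =
        P.real (π n ⁻¹' C) - Q.real (π n ⁻¹' C) := by
      intro C hC
      have h0 := hinv n 0 C hC
      have : (d n).real (π n ⁻¹' C) = (d' n).real (π n ⁻¹' C) := by
        rw [measureReal_def, measureReal_def,
          ← Measure.map_apply (hπ n) hC, ← Measure.map_apply (hπ n) hC, hdd]
      rw [hRd n, hRd' n, add_zero, measureReal_add_apply, measureReal_add_apply] at h0
      linarith
    have hfull : ∀ (M : Measure E) [IsFiniteMeasure M],
        M.real univ = M.real (π n ⁻¹' B) + M.real (π n ⁻¹' Bᶜ) := fun M _ => by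
      rw [preimage_compl, measureReal_add_measureReal_compl (hπ n hB)]
    have h1 : (R (n + 1)).real (π n ⁻¹' B) = 0 := by rw [measureReal_def, hB1]; rfl
    have h2 : (R' (n + 1)).real (π n ⁻¹' Bᶜ) = 0 := by rw [measureReal_def, hB2]; rfl
    have a1 := abs_le.1 (hN n hn B hB)
    have a2 := abs_le.1 (hN n hn Bᶜ hB.compl)
    have b1 := hsub hB
    have b2 := hsub hB.compl
    rw [hfull (R (n + 1)), hfull (R' (n + 1))]
    constructor <;> linarith
  have hsum : ∀ (S s : ℕ → Measure E), (∀ n, IsFiniteMeasure (S n)) →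
      (∀ n, S n = s n + S (n + 1)) →
      (∀ ε : ℝ, 0 < ε → ∃ N, ∀ n, N ≤ n → (S (n + 1)).real univ ≤ ε) →
      Measure.sum s = S 0 := by
    intro S s hS hrec hlim
    ext B hB
    rw [Measure.sum_apply _ hB]
    have hpart : ∀ n, S 0 B = ∑ k ∈ Finset.range n, s k B + S n B := by
      intro n
      induction n with
      | zero => simp
      | succ n ih =>
        rw [ih, Finset.sum_range_succ, hrec n, Measure.add_apply, add_assoc]
    have ht : Tendsto (fun n => S n B) atTop (𝓝 0) := by
      rw [ENNReal.tendsto_atTop_zero]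
      intro ε hε
      rcases eq_or_ne ε ⊤ with rfl | hε'
      · exact ⟨0, fun n _ => le_top⟩
      obtain ⟨N, hN⟩ := hlim ε.toReal (ENNReal.toReal_pos hε.ne' hε')
      refine ⟨N + 1, fun n hn => ?_⟩
      obtain ⟨k, rfl⟩ : ∃ k, n = k + 1 := ⟨n - 1, by omega⟩
      refine (measure_mono (subset_univ B)).trans ?_
      exact (ENNReal.toReal_le_toReal (measure_ne_top _ _) hε').1 (hN k (by omega))
    have h1 := (ENNReal.tendsto_nat_tsum fun k => s k B).add ht
    rw [add_zero] at h1
    refine tendsto_nhds_unique h1 ?_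
    exact tendsto_const_nhds.congr hpart
  have hP := hsum R d hRfin hRd fun ε hε => (hmass ε hε).imp fun N h n hn => (h n hn).1
  have hQ := hsum R' d' hRfin' hRd' fun ε hε => (hmass ε hε).imp fun N h n hn => (h n hn).2
  choose ρ hρ1 hρ2 hρ3 using fun n => exists_coupling_of_map_eq (hπ n) (hdd n)
  refine ⟨Measure.sum ρ, ?_, ?_, ?_⟩
  · rw [Measure.map_sum measurable_fst.aemeasurable]
    simp only [hρ1, hP, hR0]
  · rw [Measure.map_sum measurable_snd.aemeasurable]
    simp only [hρ2, hQ, hR0']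
  · rw [Measure.ae_sum_iff]
    intro n
    filter_upwards [hρ3 n] with p hp using ⟨n, hp⟩

end Gluing

/-! ### Characterisations of the coupling set; subgroup and measurability -/

section CouplingSet

variable {G : Type u} [AddCommGroup G] [MeasurableSpace G]

lemma inf_eq_zero_iff_mutuallySingular {E : Type*} [MeasurableSpace E] {ν ν' : Measure E} :
    ν ⊓ ν' = 0 ↔ ν ⟂ₘ ν' := by
  rw [Measure.mutuallySingular_iff_disjoint, disjoint_iff]
  rfl

lemma IsRandomWalk.isProbabilityMeasure [MeasurableAdd₂ G] {μ : Measure G}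
    [IsProbabilityMeasure μ] {Ω : Type*} [MeasurableSpace Ω] {P : Measure Ω} {S : ℕ → Ω → G}
    {x : G} (hS : IsRandomWalk x μ P S) : IsProbabilityMeasure P := by
  have h := congrArg (fun m : Measure (ℕ → G) => m univ) hS.map_eq
  simp only [Measure.map_apply (measurable_pi_iff.2 hS.measurable) MeasurableSet.univ,
    preimage_univ, measure_univ] at h
  exact ⟨h⟩

lemma Merges.exists_inf_ne_zero [MeasurableAdd₂ G] {μ : Measure G} [IsProbabilityMeasure μ] {x : G}
    (h : Merges μ x) :
    ∃ n : ℕ, 1 ≤ n ∧ convPow μ n ⊓ shift (-x) (convPow μ n) ≠ 0 := by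
  obtain ⟨N, hN⟩ := h (1 / 2) (by norm_num)
  refine ⟨N + 1, by omega, fun h0 => ?_⟩
  obtain ⟨B, hB, hB1, hB2⟩ := inf_eq_zero_iff_mutuallySingular.1 h0
  -- From the starting point `-x` the difference compares `shift (-x)` of the law with the law
  -- itself; a separating set would make it equal to one.
  have hb := hN (N + 1) (by omega) _ (boundedMeasurable_indicator hB) (-x)
  have h1 : (shift (-x) (convPow μ (N + 1))).real B = 1 := by
    have := probReal_add_probReal_compl (μ := shift (-x) (convPow μ (N + 1))) hB
    rwa [measureReal_def _ Bᶜ, hB2, ENNReal.toReal_zero, add_zero] at this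
  have h2 : (shift 0 (convPow μ (N + 1))).real B = 0 := by
    rw [shift_zero, measureReal_def, hB1, ENNReal.toReal_zero]
  rw [transOp_iterate_diff μ (boundedMeasurable_indicator hB), diff, neg_add_cancel,
    ← convPow_real _ hB, ← convPow_real _ hB, h1, h2] at hb
  norm_num at hb

lemma merges_iff_exists_inf_ne_zero [MeasurableAdd₂ G] {μ : Measure G} [IsProbabilityMeasure μ]
    {x : G} :
    Merges μ x ↔ ∃ n : ℕ, 1 ≤ n ∧ convPow μ n ⊓ shift (-x) (convPow μ n) ≠ 0 :=
  ⟨Merges.exists_inf_ne_zero, fun ⟨_, hn, h⟩ => merges_of_inf_ne_zero μ hn h⟩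

lemma IsSuccessfulExactCoupling.merges [MeasurableAdd₂ G] {μ : Measure G}
    [IsProbabilityMeasure μ] {x : G} {Ω : Type*} [MeasurableSpace Ω] {P : Measure Ω}
    {S S' : ℕ → Ω → G} {T : Ω → ℕ∞} (h : IsSuccessfulExactCoupling μ 0 x P S S' T) :
    Merges μ x := by
  have := h.left.isProbabilityMeasure
  -- The coupled walks have laws `μ^n` and its shift by `x`, which is the criterion for `-x`;
  -- symmetry of `Merges` repairs the sign.
  suffices h' : ∃ n : ℕ, 1 ≤ n ∧ convPow μ n ⊓ shift x (convPow μ n) ≠ 0 by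
    have := (merges_iff_exists_inf_ne_zero (μ := μ) (x := -x)).2 (by rwa [neg_neg])
    simpa using this.neg
  by_contra! hcon
  have hnull : ∀ n : ℕ, P {ω | T ω ≤ (n + 1 : ℕ)} = 0 := by
    intro n
    obtain ⟨B, hB, hB1, hB2⟩ := inf_eq_zero_iff_mutuallySingular.1 (hcon (n + 1) (by omega))
    rw [← shift_zero (convPow μ (n + 1)), ← h.left.map_eval,
      Measure.map_apply (h.left.measurable _) hB] at hB1
    rw [← h.right.map_eval, Measure.map_apply (h.right.measurable _) hB.compl] at hB2
    refine measure_mono_null (fun ω hω => ?_) (measure_union_null hB1 hB2)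
    have e := h.eq_of_time_le ω (n + 1) hω
    by_cases hm : S (n + 1) ω ∈ B
    · exact Or.inl hm
    · exact Or.inr fun hm' => hm (e ▸ hm')
  have hall : ∀ᵐ ω ∂P, ∀ n : ℕ, ¬ T ω ≤ (n + 1 : ℕ) := by
    rw [ae_all_iff]
    intro n
    rw [ae_iff]
    simpa using hnull n
  have hfalse : ∀ᵐ ω ∂P, False := by
    filter_upwards [hall, h.time_lt_top] with ω h1 h2
    obtain ⟨k, hk⟩ := ENat.ne_top_iff_exists.1 h2.ne
    refine h1 k ?_
    rw [← hk]
    exact_mod_cast Nat.le_succ k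
  exact IsProbabilityMeasure.ne_zero P (by simpa using hfalse)

lemma mem_couplingSet_of_merges [StandardBorelSpace G] [MeasurableAdd₂ G] {μ : Measure G}
    [IsProbabilityMeasure μ] {x : G} (h : Merges μ x) : x ∈ couplingSet μ := by
  classical
  have hπσ : ∀ n k, (tail (n + k) : (ℕ → G) → ℕ → G) = tail k ∘ tail n := by
    intro n k
    funext ω j
    simp only [tail, Function.comp_apply]
    congr 1
    ring
  obtain ⟨ρ, h1, h2, h3⟩ := exists_eventual_coupling (P := rwLaw 0 μ) (Q := rwLaw x μ)
    (fun n => measurable_tail n) (fun n => measurable_tail n) hπσ (by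
      intro ε hε
      obtain ⟨N, hN⟩ := h ε hε
      refine ⟨N, fun n hn B hB => ?_⟩
      have := hN n hn _ (boundedMeasurable_rwLaw μ hB) 0
      rwa [transOp_iterate_diff μ (boundedMeasurable_rwLaw μ hB), diff, zero_add,
        ← rwLaw_real_tail μ _ n hB, ← rwLaw_real_tail μ _ n hB] at this)
  have hL : IsRandomWalk 0 μ ρ fun (n : ℕ) (p : (ℕ → G) × (ℕ → G)) => p.1 n :=
    ⟨fun n => (measurable_pi_apply n).comp measurable_fst, h1⟩
  have hR : IsRandomWalk x μ ρ fun (n : ℕ) (p : (ℕ → G) × (ℕ → G)) => p.2 n :=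
    ⟨fun n => (measurable_pi_apply n).comp measurable_snd, h2⟩
  have hset : ∀ n : ℕ, MeasurableSet {p : (ℕ → G) × (ℕ → G) | tail n p.1 = tail n p.2} :=
    fun n => measurableSet_eq_fun ((measurable_tail n).comp measurable_fst)
      ((measurable_tail n).comp measurable_snd)
  have : BorelSpace ℕ∞ := ⟨borel_eq_top_of_countable.symm⟩
  refine ⟨(ℕ → G) × (ℕ → G), inferInstance, ρ, hL.isProbabilityMeasure, _, _,
    fun p => ⨅ n : ℕ, if tail n p.1 = tail n p.2 then (n : ℕ∞) else ⊤,
    ⟨⟨hL, hR, ?_, ?_⟩, ?_⟩⟩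
  · exact Measurable.iInf fun n => Measurable.ite (hset n) measurable_const measurable_const
  · intro p n hn
    -- A strict bound on the infimum yields an actual index `k ≤ n` at which the tails agree.
    have hlt := hn.trans_lt (by exact_mod_cast Nat.lt_succ_self n : (n : ℕ∞) < (n + 1 : ℕ))
    obtain ⟨k, hk⟩ := iInf_lt_iff.1 hlt
    split_ifs at hk with he
    · have hkn : k ≤ n := Nat.lt_succ_iff.1 (by exact_mod_cast hk)
      have := congrFun he (n - k)
      simpa [tail, Nat.sub_add_cancel hkn] using this
    · exact absurd hk (not_lt.2 le_top)
  · filter_upwards [h3] with p ⟨n, hn⟩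
    refine (iInf_le _ n).trans_lt ?_
    rw [if_pos hn]
    exact ENat.natCast_lt_top n

lemma mem_couplingSet_iff_merges [StandardBorelSpace G] [MeasurableAdd₂ G] {μ : Measure G}
    [IsProbabilityMeasure μ] {x : G} : x ∈ couplingSet μ ↔ Merges μ x :=
  ⟨fun ⟨_, _, _, _, _, _, _, h⟩ => h.merges, mem_couplingSet_of_merges⟩

lemma mem_couplingSet_iff_exists_inf_ne_zero [StandardBorelSpace G] [MeasurableAdd₂ G]
    {μ : Measure G} [IsProbabilityMeasure μ] {x : G} :
    x ∈ couplingSet μ ↔ ∃ n : ℕ, 1 ≤ n ∧ convPow μ n ⊓ shift (-x) (convPow μ n) ≠ 0 :=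
  mem_couplingSet_iff_merges.trans merges_iff_exists_inf_ne_zero

/-- The successful exact coupling set as a subgroup. -/
def couplingSubgroup [StandardBorelSpace G] [MeasurableAdd₂ G] (μ : Measure G)
    [IsProbabilityMeasure μ] : AddSubgroup G where
  carrier := couplingSet μ
  zero_mem' := mem_couplingSet_iff_merges.2 (merges_zero μ)
  add_mem' h h' := mem_couplingSet_iff_merges.2
    ((mem_couplingSet_iff_merges.1 h).add (mem_couplingSet_iff_merges.1 h'))
  neg_mem' h := mem_couplingSet_iff_merges.2 (mem_couplingSet_iff_merges.1 h).neg

lemma measurableSet_couplingSet [StandardBorelSpace G] [MeasurableAdd₂ G] [MeasurableNeg G]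
    (μ : Measure G) [IsProbabilityMeasure μ] : MeasurableSet (couplingSet μ) := by
  have e : couplingSet μ =
      ⋃ n : ℕ, {x | ¬ convPow μ (n + 1) ⟂ₘ shift (-x) (convPow μ (n + 1))} := by
    ext x
    rw [mem_couplingSet_iff_exists_inf_ne_zero, mem_iUnion]
    simp only [mem_ofPred_eq, ← inf_eq_zero_iff_mutuallySingular]
    constructor
    · rintro ⟨n, hn, h⟩
      obtain ⟨k, rfl⟩ : ∃ k, n = k + 1 := ⟨n - 1, by omega⟩
      exact ⟨k, h⟩
    · rintro ⟨k, h⟩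
      exact ⟨k + 1, by omega, h⟩
  rw [e]
  refine MeasurableSet.iUnion fun n => ?_
  let κ : ProbabilityTheory.Kernel G G := ⟨fun x => shift (-x) (convPow μ (n + 1)), by
    refine Measure.measurable_of_measurable_coe _ fun B hB => ?_
    have hm : Measurable fun p : G × G => -p.1 + p.2 := measurable_fst.neg.add measurable_snd
    have : (fun x : G => shift (-x) (convPow μ (n + 1)) B) = fun x : G =>
        convPow μ (n + 1) (Prod.mk x ⁻¹' ((fun p : G × G => -p.1 + p.2) ⁻¹' B)) := by
      funext x
      rw [shift, Measure.map_apply (measurable_const_add (-x)) hB]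
      rfl
    rw [this]
    exact measurable_measure_prodMk_left (hm hB)⟩
  have : ProbabilityTheory.IsMarkovKernel κ := ⟨fun x => isProbabilityMeasure_shift _ _⟩
  exact (ProbabilityTheory.Kernel.measurableSet_mutuallySingular
    (ProbabilityTheory.Kernel.const G (convPow μ (n + 1))) κ).compl

end CouplingSet

/-! ### Purely atomic step distributions -/

section Atomic

lemma countable_atoms {E : Type*} [MeasurableSpace E] [MeasurableSingletonClass E]
    (μ : Measure E) [SFinite μ] :
    (atoms μ).Countable := by
  have := Measure.countable_meas_level_set_pos (μ := μ) (measurable_id (α := E))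
  refine this.mono fun a ha => ?_
  simpa using pos_iff_ne_zero.2 ha

lemma countable_closure_of_countable {G : Type*} [AddCommGroup G] {s : Set G} (hs : s.Countable) :
    (AddSubgroup.closure s : Set G).Countable := by
  have := hs.to_subtype
  have e : (AddSubgroup.closure s : Set G) =
      range (Finsupp.linearCombination ℤ ((↑) : s → G)) := by
    rw [← LinearMap.coe_range, Finsupp.range_linearCombination, Subtype.range_coe,
      ← Submodule.span_int_eq_addSubgroupClosure]
    rfl
  rw [e]
  exact countable_range _

variable {G : Type u} [AddCommGroup G] [MeasurableSpace G]

lemma ae_convPow_mem_coset [MeasurableSingletonClass G] [MeasurableAdd₂ G] {μ : Measure G}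
    [IsProbabilityMeasure μ] {H : AddSubgroup G} (hH : (H : Set G).Countable) {a : G}
    (h : ∀ᵐ y ∂μ, y - a ∈ H) (n : ℕ) : ∀ᵐ y ∂convPow μ n, y - n • a ∈ H := by
  have hms : ∀ b : G, MeasurableSet {y | y - b ∈ H} := fun b => by
    refine (Countable.mono (fun y hy => ?_) (hH.image (fun z => z + b))).measurableSet
    exact ⟨y - b, hy, sub_add_cancel y b⟩
  induction n with
  | zero =>
    rw [convPow, ae_dirac_iff (by simpa using hms 0)]
    simp
  | succ n ih =>
    rw [convPow, Measure.conv, ae_map_iff measurable_add.aemeasurable (hms _)]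
    have h1 := (Measure.quasiMeasurePreserving_fst (μ := convPow μ n) (ν := μ)).ae ih
    have h2 := (Measure.quasiMeasurePreserving_snd (μ := convPow μ n) (ν := μ)).ae h
    filter_upwards [h1, h2] with p hp hp'
    have : p.1 + p.2 - (n + 1) • a = (p.1 - n • a) + (p.2 - a) := by
      rw [succ_nsmul]; abel
    rw [this]
    exact H.add_mem hp hp'

lemma couplingSet_eq_closure [StandardBorelSpace G] [MeasurableAdd₂ G] {μ : Measure G}
    [IsProbabilityMeasure μ] (hμ : IsPurelyAtomic μ) :
    couplingSet μ = (AddSubgroup.closure (atoms μ - atoms μ) : Set G) := by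
  refine Subset.antisymm (fun x hx => ?_) ?_
  · set H := AddSubgroup.closure (atoms μ - atoms μ)
    have hH : (H : Set G).Countable := countable_closure_of_countable
      ((countable_atoms μ).image2 (countable_atoms μ) (· - ·))
    have hae : ∀ᵐ y ∂μ, y ∈ atoms μ := hμ
    obtain ⟨a, ha⟩ := hae.exists
    have hcos := ae_convPow_mem_coset hH (a := a)
      (hae.mono fun y hy => AddSubgroup.subset_closure (sub_mem_sub hy ha))
    obtain ⟨n, -, hn⟩ := mem_couplingSet_iff_exists_inf_ne_zero.1 hx
    by_contra hxH
    refine hn (inf_eq_zero_iff_mutuallySingular.2 ?_)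
    have hms : MeasurableSet {y | y - n • a ∈ H} := by
      refine (Countable.mono (fun y hy => ?_) (hH.image (fun z => z + n • a))).measurableSet
      exact ⟨y - n • a, hy, sub_add_cancel y _⟩
    -- `μ^n` lives on the coset `n • a + H` and its shift on `-x + n • a + H`; these are disjoint
    -- when `x ∉ H`.
    refine Measure.MutuallySingular.symm ⟨{y | y - n • a ∈ H}, hms, ?_, hcos n⟩
    rw [shift, Measure.map_apply (measurable_const_add _) hms]
    refine measure_mono_null (t := {y | ¬ (y - n • a ∈ H)}) (fun y hy hy' => hxH ?_) (hcos n)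
    have e : x = (y - n • a) - (-x + y - n • a) := by abel
    rw [e]
    exact H.sub_mem hy' hy
  · change AddSubgroup.closure _ ≤ couplingSubgroup μ
    rw [AddSubgroup.closure_le]
    rintro _ ⟨a, ha, b, hb, rfl⟩
    refine mem_couplingSet_iff_exists_inf_ne_zero.2 ⟨1, le_rfl, fun h0 => ?_⟩
    have h1 : convPow μ 1 = μ := by rw [convPow, convPow, Measure.dirac_zero_conv]
    obtain ⟨B, hB, hB1, hB2⟩ := inf_eq_zero_iff_mutuallySingular.1 h0
    rw [h1] at hB1 hB2
    rw [shift, Measure.map_apply (measurable_const_add _) hB.compl] at hB2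
    -- Both `μ` and its shift by `-(a - b)` have an atom at `b`, the latter coming from `a`, so no
    -- set separates them.
    by_cases hbB : b ∈ B
    · exact hb (measure_mono_null (singleton_subset_iff.2 hbB) hB1)
    · refine ha (measure_mono_null (singleton_subset_iff.2 ?_) hB2)
      simpa using hbB

end Atomic

/-! ### Spread out distributions on locally compact groups -/

section SpreadOut

open Topology Filter

lemma exists_isCompact_pos_density {E : Type*} [TopologicalSpace E] [MeasurableSpace E]
    {ν : Measure E} [ν.InnerRegular] {f : E → ℝ≥0∞}
    (hf : Measurable f) (hf0 : ¬ f =ᵐ[ν] 0) :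
    ∃ k : Set E, IsCompact k ∧ ν k ≠ 0 ∧ ∀ y ∈ k, f y ≠ 0 := by
  have hpos : 0 < ν {y | f y ≠ 0} := pos_iff_ne_zero.2 hf0
  obtain ⟨k, hks, hk, hk0⟩ :=
    (hf (measurableSet_singleton 0).compl).exists_lt_isCompact hpos
  exact ⟨k, hk, hk0.ne', hks⟩

lemma measure_inter_eq_zero_of_withDensity_null {E : Type*} [MeasurableSpace E]
    {ν : Measure E} {f : E → ℝ≥0∞} (hf : Measurable f) {k s : Set E}
    (hfk : ∀ y ∈ k, f y ≠ 0) (h : ν.withDensity f s = 0) :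
    ν (s ∩ k) = 0 :=
  measure_mono_null (t := {y | f y ≠ 0} ∩ s) (fun y hy => ⟨hfk y hy.2, hy.1⟩)
    ((withDensity_apply_eq_zero hf).1 h)

variable {G : Type u} [AddCommGroup G] [TopologicalSpace G] [IsTopologicalAddGroup G]
  [PolishSpace G] [MeasurableSpace G] [BorelSpace G]

/-- Let `B` be a Haar-null set carrying `ν`. By Fubini and invariance, almost every translate of `ν`
gives `B` mass zero. -/
lemma ae_mutuallySingular_shift {ν haar : Measure G} [SFinite ν] [SFinite haar]
    [haar.IsAddLeftInvariant] (h : ν ⟂ₘ haar) : ∀ᵐ x ∂haar, ν ⟂ₘ shift x ν := by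
  obtain ⟨B, hB, hB1, hB2⟩ := h.symm
  have hm : Measurable fun p : G × G => p.1 + p.2 := measurable_add
  have h0 : (haar.prod ν) ((fun p : G × G => p.1 + p.2) ⁻¹' B) = 0 := by
    rw [Measure.prod_apply_symm (hm hB)]
    refine (lintegral_congr fun y => ?_).trans lintegral_zero
    have : (fun x => (x, y)) ⁻¹' ((fun p : G × G => p.1 + p.2) ⁻¹' B) =
        (fun x => y + x) ⁻¹' B := by
      ext x
      simp [add_comm]
    rw [this, measure_preimage_add, hB1]
  filter_upwards [Measure.measure_ae_null_of_prod_null h0] with x hx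
  refine Measure.MutuallySingular.symm ⟨B, hB, ?_, hB2⟩
  rw [shift, Measure.map_apply (measurable_const_add x) hB]
  exact hx

variable {μ : Measure G} [IsProbabilityMeasure μ] {haar : Measure G}

lemma isSpreadOut_of_couplingSet_eq_univ [SigmaFinite haar] [NeZero haar]
    [haar.IsAddLeftInvariant] (h : couplingSet μ = univ) : IsSpreadOut haar μ := by
  by_contra hns
  have hsing : ∀ n : ℕ, convPow μ (n + 1) ⟂ₘ haar := fun n => by
    by_contra hn
    exact hns ⟨n + 1, by omega, (convPow μ (n + 1)).rnDeriv haar, Measure.measurable_rnDeriv _ _,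
      fun h0 => hn ((Measure.rnDeriv_eq_zero _ _).1 h0), Measure.withDensity_rnDeriv_le _ _⟩
  have hae : ∀ᵐ x ∂haar, ∀ n : ℕ, convPow μ (n + 1) ⟂ₘ shift x (convPow μ (n + 1)) :=
    ae_all_iff.2 fun n => ae_mutuallySingular_shift (hsing n)
  obtain ⟨x, hx⟩ := hae.exists
  have hmem : -x ∈ couplingSet μ := h ▸ mem_univ _
  obtain ⟨n, hn, hne⟩ := mem_couplingSet_iff_exists_inf_ne_zero.1 hmem
  obtain ⟨k, rfl⟩ : ∃ k, n = k + 1 := ⟨n - 1, by omega⟩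
  rw [neg_neg] at hne
  exact hne (inf_eq_zero_iff_mutuallySingular.2 (hx k))

/-- On a compact `k` of positive measure the density is nonzero. For small `x` the translate `-x +ᵥ
k` overlaps `k` in positive measure, whereas singularity would make that overlap null. -/
lemma couplingSet_mem_nhds_zero_of_isSpreadOut [LocallyCompactSpace G] [haar.IsAddHaarMeasure]
    (h : IsSpreadOut haar μ) : couplingSet μ ∈ 𝓝 (0 : G) := by
  obtain ⟨n, hn, f, hf, hf0, hle⟩ := h
  obtain ⟨k, hk, hk0, hfk⟩ := exists_isCompact_pos_density hf hf0
  have hev := eventually_nhds_zero_measure_vadd_sdiff_lt (μ := haar) hk hk.isClosed hk0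
  have hneg : ∀ᶠ g : G in 𝓝 0, haar (((-g : G) +ᵥ k) \ k) < haar k := by
    have : Tendsto (fun g : G => -g) (𝓝 0) (𝓝 0) := by
      simpa using (continuous_neg (G := G)).tendsto 0
    exact this.eventually hev
  filter_upwards [hneg] with x hx
  refine mem_couplingSet_iff_exists_inf_ne_zero.2 ⟨n, hn, fun h0 => ?_⟩
  obtain ⟨B, hB, hB1, hB2⟩ := inf_eq_zero_iff_mutuallySingular.1 h0
  rw [shift, Measure.map_apply (measurable_const_add _) hB.compl] at hB2
  have h1 := measure_inter_eq_zero_of_withDensity_null hf hfk (le_antisymm (hB1 ▸ hle B) zero_le)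
  have h2 := measure_inter_eq_zero_of_withDensity_null hf hfk
    (le_antisymm (hB2 ▸ hle ((fun y => -x + y) ⁻¹' Bᶜ)) zero_le)
  have h3 : haar ((-x +ᵥ k) ∩ Bᶜ) = 0 := by
    have e : (fun y => -x + y) ⁻¹' Bᶜ ∩ k = (fun y => -x + y) ⁻¹' (Bᶜ ∩ (-x +ᵥ k)) := by
      ext y
      simp [mem_vadd_set]
    rw [e, measure_preimage_add] at h2
    rwa [inter_comm]
  have h4 : haar (-x +ᵥ k) = haar k := measure_vadd haar (-x) k
  refine absurd hx (not_lt.2 ?_)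
  calc haar k = haar (-x +ᵥ k) := h4.symm
    _ ≤ haar (((-x +ᵥ k) \ k) ∪ (((-x +ᵥ k) ∩ Bᶜ) ∪ (B ∩ k))) := by
        refine measure_mono fun y hy => ?_
        by_cases hyk : y ∈ k
        · by_cases hyB : y ∈ B
          · exact Or.inr (Or.inr ⟨hyB, hyk⟩)
          · exact Or.inr (Or.inl ⟨hy, hyB⟩)
        · exact Or.inl ⟨hy, hyk⟩
    _ ≤ haar ((-x +ᵥ k) \ k) + 0 :=
        (measure_union_le _ _).trans (add_le_add le_rfl (measure_union_null h3 h1).le)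
    _ = _ := add_zero _

/-- A subgroup that is a neighbourhood of zero is open, hence closed, and connectedness leaves only
the whole group. -/
lemma couplingSet_eq_univ_of_isSpreadOut [LocallyCompactSpace G] [haar.IsAddHaarMeasure]
    [ConnectedSpace G] (h : IsSpreadOut haar μ) : couplingSet μ = univ := by
  have hopen : IsOpen (couplingSubgroup μ : Set G) :=
    (couplingSubgroup μ).isOpen_of_mem_nhds (couplingSet_mem_nhds_zero_of_isSpreadOut h)
  exact IsClopen.eq_univ (s := couplingSet μ)
    ⟨(couplingSubgroup μ).isClosed_of_isOpen hopen, hopen⟩ ⟨0, (couplingSubgroup μ).zero_mem⟩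

end SpreadOut

end ExactCoupling

theorem theorem3 {G : Type u} [AddCommGroup G] [TopologicalSpace G]
    [IsTopologicalAddGroup G] [PolishSpace G] [MeasurableSpace G] [BorelSpace G]
    (μ : Measure G) [IsProbabilityMeasure μ] :
    -- (a)
    (ExactCoupling.couplingSet μ =
      {x : G | ∃ n : ℕ, 1 ≤ n ∧
        ExactCoupling.convPow μ n ⊓
          ExactCoupling.shift (-x) (ExactCoupling.convPow μ n) ≠ 0}) ∧
    -- (b)
    (∀ x ∈ ExactCoupling.couplingSet μ, ∀ n₀ : ℕ, 1 ≤ n₀ →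
      ExactCoupling.convPow μ n₀ ⊓
        ExactCoupling.shift (-x) (ExactCoupling.convPow μ n₀) ≠ 0 →
      ∃ C : ℝ, 0 < C ∧
        (¬ IsOfFinAddOrder x →
          ∀ (Ω : Type v) [MeasurableSpace Ω] (P : Measure Ω) [IsProbabilityMeasure P]
            (S S' : ℕ → Ω → G),
            ExactCoupling.IsRandomWalk 0 μ P S → ExactCoupling.IsRandomWalk x μ P S' →
            ∀ n : ℕ, 1 ≤ n → ExactCoupling.tvDist P (S n) (S' n) ≤ C / Real.sqrt n) ∧
        (IsOfFinAddOrder x →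
          ∃ ρ : ℝ, 0 < ρ ∧ ρ < 1 ∧
            ∀ (Ω : Type v) [MeasurableSpace Ω] (P : Measure Ω) [IsProbabilityMeasure P]
              (S S' : ℕ → Ω → G),
              ExactCoupling.IsRandomWalk 0 μ P S → ExactCoupling.IsRandomWalk x μ P S' →
              ∀ n : ℕ, 1 ≤ n → ExactCoupling.tvDist P (S n) (S' n) ≤ C * ρ ^ n)) ∧
    -- (c)
    (∀ [LocallyCompactSpace G] (haar : Measure G) [haar.IsAddHaarMeasure],
      (ExactCoupling.couplingSet μ = Set.univ → ExactCoupling.IsSpreadOut haar μ) ∧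
      (ConnectedSpace G → ExactCoupling.IsSpreadOut haar μ →
        ExactCoupling.couplingSet μ = Set.univ)) ∧
    -- (d)
    (ExactCoupling.IsPurelyAtomic μ →
      ExactCoupling.couplingSet μ =
        (AddSubgroup.closure (ExactCoupling.atoms μ - ExactCoupling.atoms μ) : Set G)) ∧
    -- (e)
    (MeasurableSet (ExactCoupling.couplingSet μ) ∧
      ∃ H : AddSubgroup G, (H : Set G) = ExactCoupling.couplingSet μ) := by
  refine ⟨?_, fun x _ n₀ hn₀ h => ?_, ?_, ExactCoupling.couplingSet_eq_closure,
    ExactCoupling.measurableSet_couplingSet μ, ExactCoupling.couplingSubgroup μ, rfl⟩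
  · ext x
    exact ExactCoupling.mem_couplingSet_iff_exists_inf_ne_zero
  · by_cases hx : IsOfFinAddOrder x
    · obtain ⟨C, ρ, hC, hρ, hρ1, hb⟩ :=
        ExactCoupling.exists_abs_transOp_iterate_diff_le_pow μ hx hn₀ h
      refine ⟨2 * C, by positivity, fun hx' => absurd hx hx', fun _ => ⟨ρ, hρ, hρ1, ?_⟩⟩
      intro Ω _ P _ S S' hS hS' n _
      rw [mul_assoc]
      exact ExactCoupling.tvDist_le hS hS' fun f hf y => by simpa using hb f 1 hf n y
    · obtain ⟨C, hC, hb⟩ := ExactCoupling.exists_abs_transOp_iterate_diff_le_sqrt μ hn₀ h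
      refine ⟨2 * C, by positivity, fun _ => ?_, fun hx' => absurd hx' hx⟩
      intro Ω _ P _ S S' hS hS' n hn
      rw [mul_div_assoc]
      exact ExactCoupling.tvDist_le hS hS' fun f hf y => by simpa using hb f 1 hf n hn y
  · intro _ haar _
    exact ⟨ExactCoupling.isSpreadOut_of_couplingSet_eq_univ, fun _ =>
      ExactCoupling.couplingSet_eq_univ_of_isSpreadOut⟩
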